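/- Let $k$ be an algebraically closed field and let $Q_3$ be the 3-Kronecker quiver, with two vertices $x,y$ and three arrows $x\to y$. A $Q_3$-representation $M$ consists of finite-dimensional $k$-vector spaces $M(x),M(y)$ and three linear maps $M(x)\to M(y)$; put $\dim M=\dim_k M(x)+\dim_k M(y)$, which is also the length of $M$. A representation is indecomposable if it is nonzero and not isomorphic to a direct sum of two nonzero representations. Accessible representations are defined inductively: every simple representation is accessible, and a representation $M$ of length $l>1$ is accessible if it is indecomposable and has an accessible subrepresentation or an accessible factor representation of length $l-1$. Let $M$ be an indecomposable $Q_3$-representation with $\dim M\le 6$. 1. If $M$ is not simple, there is an exact sequence $0\to U_1\to M\to U_2\to 0$ of $Q_3$-representations such that $U_1$ and $U_2$ are indecomposable and at least one of $U_1,U_2$ is simple. 2. $M$ is accessible. -/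

import Mathlib

universe u v

/-- A finite-dimensional representation over `k` of the `n`-Kronecker quiver: two vertices `x`, `y`
and `n` arrows `x ⟶ y`. -/
structure KroneckerRep (n : ℕ) (k : Type u) [Field k] where
  /-- the space at the source -/
  X : Type v
  /-- the space at the sink -/
  Y : Type v
  [addCommGroupX : AddCommGroup X]
  [addCommGroupY : AddCommGroup Y]
  [moduleX : Module k X]
  [moduleY : Module k Y]
  [finiteX : FiniteDimensional k X]
  [finiteY : FiniteDimensional k Y]
  /-- the linear maps along the arrows -/
  map : Fin n → X →ₗ[k] Y

namespace KroneckerRep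

attribute [instance] addCommGroupX addCommGroupY moduleX moduleY finiteX finiteY

variable {n : ℕ} {k : Type u} [Field k]

/-- Morphisms of representations. -/
@[ext]
structure Hom (M N : KroneckerRep.{u, v} n k) where
  /-- the component at the source -/
  x : M.X →ₗ[k] N.X
  /-- the component at the sink -/
  y : M.Y →ₗ[k] N.Y
  comm : ∀ i, y ∘ₗ M.map i = N.map i ∘ₗ x

/-- A morphism is a monomorphism if it is injective at both vertices. -/
def Hom.Injective {M N : KroneckerRep.{u, v} n k} (f : Hom M N) : Prop :=
  Function.Injective f.x ∧ Function.Injective f.y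

/-- A morphism is an epimorphism if it is surjective at both vertices. -/
def Hom.Surjective {M N : KroneckerRep.{u, v} n k} (f : Hom M N) : Prop :=
  Function.Surjective f.x ∧ Function.Surjective f.y

/-- `M` and `N` are isomorphic. -/
def IsIso (M N : KroneckerRep.{u, v} n k) : Prop :=
  ∃ f : Hom M N, f.Injective ∧ f.Surjective

/-- The sequence `0 ⟶ A ⟶ M ⟶ B ⟶ 0` given by `f` and `g` is exact. -/
def IsShortExact {A M B : KroneckerRep.{u, v} n k} (f : Hom A M) (g : Hom M B) : Prop :=
  f.Injective ∧ g.Surjective ∧ Function.Exact f.x g.x ∧ Function.Exact f.y g.y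

/-- The direct sum of two representations. -/
def prod (A B : KroneckerRep.{u, v} n k) : KroneckerRep.{u, v} n k where
  X := A.X × B.X
  Y := A.Y × B.Y
  map i := (A.map i).prodMap (B.map i)

/-- The total dimension `dim M(x) + dim M(y)`; this is also the length of `M`, since the simple
representations are the two one-dimensional ones. -/
noncomputable def totalDim (M : KroneckerRep.{u, v} n k) : ℕ :=
  Module.finrank k M.X + Module.finrank k M.Y

/-- `M` is the zero representation. -/
def IsZero (M : KroneckerRep.{u, v} n k) : Prop :=
  Subsingleton M.X ∧ Subsingleton M.Y

/-- `M` is nonzero and is not a direct sum of two nonzero representations. -/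
def IsIndecomposable (M : KroneckerRep.{u, v} n k) : Prop :=
  ¬ M.IsZero ∧ ∀ A B : KroneckerRep.{u, v} n k, IsIso M (A.prod B) → A.IsZero ∨ B.IsZero

/-- `M` is nonzero and its only subrepresentations are zero and `M`. -/
def IsSimple (M : KroneckerRep.{u, v} n k) : Prop :=
  ¬ M.IsZero ∧ ∀ (A : KroneckerRep.{u, v} n k) (f : Hom A M),
    f.Injective → A.IsZero ∨ f.Surjective

/-- Accessible representations: the simple ones, and inductively those indecomposable ones that
have an accessible subrepresentation or an accessible factor representation whose length is
smaller by one. -/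
inductive IsAccessible : KroneckerRep.{u, v} n k → Prop
  | of_simple (M : KroneckerRep.{u, v} n k) : M.IsSimple → IsAccessible M
  | of_sub (M A : KroneckerRep.{u, v} n k) (f : Hom A M) : M.IsIndecomposable → f.Injective →
      A.totalDim + 1 = M.totalDim → IsAccessible A → IsAccessible M
  | of_quotient (M B : KroneckerRep.{u, v} n k) (g : Hom M B) : M.IsIndecomposable →
      g.Surjective → B.totalDim + 1 = M.totalDim → IsAccessible B → IsAccessible M

end KroneckerRep

/-! Everything reduces to one claim: an indecomposable of total dimension 2 to 6 stays
indecomposable after passing to some hyperplane of `M(x)`, or after factoring out some line of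
`M(y)`. The cokernel or kernel is then simple, which gives the exact sequence, and induction on the
dimension gives accessibility.

The arrows are packed into a bilinear map `f : X × V → Y` with `V = k³`; the rank of `x` means the
rank of `f x : V → Y`. Indecomposability forces the images of complementary nonzero subspaces of `X`
to generate `Y` and to meet, so their dimensions add up to at least `dim Y + 1`
(`Indecomposable.finrank_image_add`). Conversely, `f` is indecomposable once its image generates `Y`
and any two independent vectors have meeting images (`indecomposable_of_not_disjoint`), for instance
because their ranks add up to more than `dim Y`.

Duality exchanges `X` and `Y` and the two kinds of neighbour, so `dim X ≤ dim Y` may be assumed. The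
substantial dimension pairs are (2,3), (2,4) and (3,3). In (2,4) one factors out a line avoiding the
only possible image of rank two. In (2,3) without a vector of full rank, one looks for a line
contained in the images of at most one point of the projective line of `X`; this is where `k` must
be infinite. In (3,3) the vectors of rank at most one lie in a plane; either a vector of higher rank
in it yields a good plane, or the plane consists of rank one maps, with a common image or a common
kernel. -/

open Module Submodule

/-! ### Bilinear maps: criteria for indecomposability -/

namespace BilinearRep

variable {k X V Y : Type*} [Field k] [AddCommGroup X] [Module k X] [AddCommGroup V] [Module k V]
  [AddCommGroup Y] [Module k Y]

/-- A bilinear map `f : X × V → Y`, seen as a representation `X ⟶ Y` with arrows indexed by `V`, is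
indecomposable if it is nonzero and has no nontrivial internal direct sum decomposition. -/
def Indecomposable (f : X →ₗ[k] V →ₗ[k] Y) : Prop :=
  ¬ (Subsingleton X ∧ Subsingleton Y) ∧
    ∀ (X₁ X₂ : Submodule k X) (Y₁ Y₂ : Submodule k Y), IsCompl X₁ X₂ → IsCompl Y₁ Y₂ →
      (∀ x ∈ X₁, ∀ v, f x v ∈ Y₁) → (∀ x ∈ X₂, ∀ v, f x v ∈ Y₂) →
        (X₁ = ⊥ ∧ Y₁ = ⊥) ∨ (X₂ = ⊥ ∧ Y₂ = ⊥)

/-- The subspace of `Y` generated by the image of `P`. -/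
def image (f : X →ₗ[k] V →ₗ[k] Y) (P : Submodule k X) : Submodule k Y := map₂ f P ⊤

variable {f : X →ₗ[k] V →ₗ[k] Y}

theorem image_le {P : Submodule k X} {Q : Submodule k Y} :
    image f P ≤ Q ↔ ∀ x ∈ P, ∀ v, f x v ∈ Q := by
  simp [image, map₂_le]

theorem apply_mem_image {P : Submodule k X} {x : X} (hx : x ∈ P) (v : V) : f x v ∈ image f P :=
  image_le.1 le_rfl x hx v

theorem image_sup (P Q : Submodule k X) : image f (P ⊔ Q) = image f P ⊔ image f Q :=
  map₂_sup_left ..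

theorem image_span_singleton (x : X) : image f (span k {x}) = LinearMap.range (f x) := by
  rw [image, map₂_span_singleton_eq_map, LinearMap.range_eq_map]

theorem image_span_pair (x y : X) :
    image f (span k {x, y}) = LinearMap.range (f x) ⊔ LinearMap.range (f y) := by
  rw [span_insert, image_sup, image_span_singleton, image_span_singleton]

theorem range_smul {c : k} (hc : c ≠ 0) (x : X) :
    LinearMap.range (f (c • x)) = LinearMap.range (f x) := by
  rw [map_smul, LinearMap.range_smul _ _ hc]

/-- A complement of the image would be a direct summand with zero source. -/
theorem Indecomposable.image_top (hf : Indecomposable f) [Nontrivial X] : image f ⊤ = ⊤ := by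
  obtain ⟨Q, hQ⟩ := Submodule.exists_isCompl (image f ⊤)
  rcases hf.2 ⊤ ⊥ (image f ⊤) Q isCompl_top_bot hQ (fun x hx v => apply_mem_image hx v)
    (by simp) with h | h
  · exact absurd h.1 top_ne_bot
  · rw [h.2] at hQ
    simpa using hQ.sup_eq_top

/-- If the images were disjoint, one of them could be enlarged to a complement of the other, and `f`
would split. -/
theorem Indecomposable.not_disjoint_image (hf : Indecomposable f) {X₁ X₂ : Submodule k X}
    (h : IsCompl X₁ X₂) (h₁ : X₁ ≠ ⊥) (h₂ : X₂ ≠ ⊥) : ¬ Disjoint (image f X₁) (image f X₂) := by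
  intro hd
  obtain ⟨Q, hle, hQ⟩ := hd.exists_isCompl
  rcases hf.2 X₁ X₂ Q (image f X₂) h hQ (fun x hx v => hle (apply_mem_image hx v))
    (fun x hx v => apply_mem_image hx v) with h | h
  · exact h₁ h.1
  · exact h₂ h.1

/-- The two images generate `Y` and have nonzero intersection. This is the numerical form in which
indecomposability is mostly used. -/
theorem Indecomposable.finrank_image_add [FiniteDimensional k Y] (hf : Indecomposable f)
    {X₁ X₂ : Submodule k X} (h : IsCompl X₁ X₂) (h₁ : X₁ ≠ ⊥) (h₂ : X₂ ≠ ⊥) :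
    finrank k Y + 1 ≤ finrank k (image f X₁) + finrank k (image f X₂) := by
  have hne := hf.not_disjoint_image h h₁ h₂
  have : Nontrivial X := nontrivial_of_ne _ _ (exists_mem_ne_zero_of_ne_bot h₁).choose_spec.2
  have htop : image f X₁ ⊔ image f X₂ = ⊤ := by
    rw [← image_sup, h.sup_eq_top, hf.image_top]
  have hdim := finrank_sup_add_finrank_inf_eq (image f X₁) (image f X₂)
  rw [htop, finrank_top] at hdim
  have hpos : 0 < finrank k ↥(image f X₁ ⊓ image f X₂) :=
    Nat.pos_of_ne_zero fun h0 => hne (disjoint_iff.2 (finrank_eq_zero.1 h0))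
  omega

theorem not_disjoint_of_finrank_lt [FiniteDimensional k Y] {P Q : Submodule k Y}
    (h : finrank k Y < finrank k P + finrank k Q) : ¬ Disjoint P Q := by
  intro hd
  have := finrank_add_finrank_le_of_disjoint hd
  omega

/-- Indecomposability holds as soon as the images generate and the images of any two linearly
independent vectors meet. -/
theorem indecomposable_of_not_disjoint [Nontrivial X] (htop : image f ⊤ = ⊤)
    (h : ∀ x y : X, LinearIndependent k ![x, y] →
      ¬ Disjoint (LinearMap.range (f x)) (LinearMap.range (f y))) : Indecomposable f := by
  refine ⟨fun hs => not_subsingleton X hs.1, fun X₁ X₂ Y₁ Y₂ hX hY h₁ h₂ => ?_⟩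
  by_cases hX₁ : X₁ = ⊥
  · left
    subst hX₁
    have : image f ⊤ ≤ Y₂ := by
      rw [← hX.sup_eq_top, bot_sup_eq]
      exact image_le.2 h₂
    rw [htop, top_le_iff] at this
    subst this
    exact ⟨rfl, by simpa using hY.inf_eq_bot⟩
  by_cases hX₂ : X₂ = ⊥
  · right
    subst hX₂
    have : image f ⊤ ≤ Y₁ := by
      rw [← hX.sup_eq_top, sup_bot_eq]
      exact image_le.2 h₁
    rw [htop, top_le_iff] at this
    subst this
    exact ⟨rfl, by simpa using hY.inf_eq_bot⟩
  exfalso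
  obtain ⟨x, hx, hx0⟩ := exists_mem_ne_zero_of_ne_bot hX₁
  obtain ⟨y, hy, hy0⟩ := exists_mem_ne_zero_of_ne_bot hX₂
  refine h x y ?_ (hY.disjoint.mono ?_ ?_)
  · rw [LinearIndependent.pair_iff]
    intro s t hst
    have hsx : s • x ∈ X₂ := by
      rw [eq_neg_of_add_eq_zero_left hst]
      exact X₂.neg_mem (X₂.smul_mem _ hy)
    have hs := disjoint_def.1 hX.disjoint _ (X₁.smul_mem s hx) hsx
    rw [hs, zero_add] at hst
    exact ⟨(smul_eq_zero.1 hs).resolve_right hx0, (smul_eq_zero.1 hst).resolve_right hy0⟩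
  · rintro _ ⟨v, rfl⟩
    exact h₁ x hx v
  · rintro _ ⟨v, rfl⟩
    exact h₂ y hy v

/-- The restriction of `f` to a subspace of the source. -/
abbrev restrict (f : X →ₗ[k] V →ₗ[k] Y) (P : Submodule k X) : P →ₗ[k] V →ₗ[k] Y :=
  f ∘ₗ P.subtype

/-- The quotient of `f` by a subspace of the sink. -/
abbrev quotient (f : X →ₗ[k] V →ₗ[k] Y) (Q : Submodule k Y) : X →ₗ[k] V →ₗ[k] Y ⧸ Q :=
  f.compr₂ Q.mkQ

theorem indecomposable_restrict {P : Submodule k X} (hP : P ≠ ⊥) (htop : image f P = ⊤)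
    (h : ∀ x ∈ P, ∀ y ∈ P, LinearIndependent k ![x, y] →
      ¬ Disjoint (LinearMap.range (f x)) (LinearMap.range (f y))) :
    Indecomposable (restrict f P) := by
  have := nontrivial_iff_ne_bot.2 hP
  refine indecomposable_of_not_disjoint ?_ fun x y hxy => h x x.2 y y.2 ?_
  · rw [eq_top_iff, ← htop, image_le]
    exact fun x hx v => apply_mem_image (f := restrict f P) (x := ⟨x, hx⟩) mem_top v
  · rw [LinearIndependent.pair_iff] at hxy ⊢
    exact fun s t hst => hxy s t (Subtype.ext (by simpa using hst))

theorem indecomposable_restrict_span_singleton {x : X} (hx : x ≠ 0)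
    (h : LinearMap.range (f x) = ⊤) : Indecomposable (restrict f (span k {x})) := by
  refine indecomposable_restrict (by simpa using hx) (by rw [image_span_singleton, h]) ?_
  -- A line contains no independent pair, so the meeting condition is vacuous.
  intro y hy z hz hyz
  obtain ⟨a, rfl⟩ := mem_span_singleton.1 hy
  obtain ⟨b, rfl⟩ := mem_span_singleton.1 hz
  have := LinearIndependent.pair_iff.1 hyz
  have h1 := this b (-a) (by module)
  have h2 := this 1 0 (by simp [neg_eq_zero.1 h1.2])
  simp at h2

theorem range_quotient (Q : Submodule k Y) (x : X) :
    LinearMap.range (quotient f Q x) = (LinearMap.range (f x)).map Q.mkQ := by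
  rw [← LinearMap.range_comp]
  rfl

theorem indecomposable_quotient [Nontrivial X] (htop : image f ⊤ = ⊤) (Q : Submodule k Y)
    (h : ∀ x y : X, LinearIndependent k ![x, y] →
      ¬ Disjoint ((LinearMap.range (f x)).map Q.mkQ) ((LinearMap.range (f y)).map Q.mkQ)) :
    Indecomposable (quotient f Q) := by
  refine indecomposable_of_not_disjoint ?_ fun x y hxy => ?_
  · have : image f ⊤ ≤ (image (quotient f Q) ⊤).comap Q.mkQ :=
      image_le.2 fun x hx v => apply_mem_image (f := quotient f Q) hx v
    rw [htop, top_le_iff] at this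
    rw [eq_top_iff, ← range_mkQ Q, LinearMap.range_eq_map, ← this]
    exact map_comap_le _ _
  · rw [range_quotient, range_quotient]
    exact h x y hxy

theorem finrank_map_mkQ_add [FiniteDimensional k Y] (R Q : Submodule k Y) :
    finrank k (R.map Q.mkQ) + finrank k ↥(R ⊓ Q) = finrank k R := by
  have h := LinearMap.finrank_range_add_finrank_ker (Q.mkQ.domRestrict R)
  rwa [LinearMap.range_domRestrict, LinearMap.ker_domRestrict, ker_mkQ,
    ← finrank_map_subtype_eq, map_comap_subtype] at h

theorem finrank_span_singleton_le (y : Y) : finrank k (span k {y}) ≤ 1 := by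
  simpa using finrank_span_le_card (R := k) ({y} : Set Y)

theorem finrank_le_finrank_map_mkQ_add_one [FiniteDimensional k Y] (R : Submodule k Y) (y : Y) :
    finrank k R ≤ finrank k (R.map (span k {y}).mkQ) + 1 := by
  have h := finrank_map_mkQ_add R (span k {y})
  have := finrank_mono (inf_le_right : R ⊓ span k {y} ≤ _)
  have := finrank_span_singleton_le (k := k) y
  omega

theorem finrank_map_mkQ_of_notMem [FiniteDimensional k Y] {R : Submodule k Y} {y : Y}
    (hy : y ∉ R) : finrank k (R.map (span k {y}).mkQ) = finrank k R := by
  have h := finrank_map_mkQ_add R (span k {y})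
  rwa [(disjoint_span_singleton_of_notMem hy).eq_bot, finrank_bot, add_zero] at h

theorem finrank_quotient_span_singleton_add_one [FiniteDimensional k Y] {y : Y} (hy : y ≠ 0) :
    finrank k (Y ⧸ span k {y}) + 1 = finrank k Y := by
  rw [← finrank_quotient_add_finrank (span k {y}), finrank_span_singleton hy]

theorem isCompl_span_singleton [FiniteDimensional k X] (hX : finrank k X = 2) {x y : X}
    (h : LinearIndependent k ![x, y]) : IsCompl (span k {x}) (span k {y}) := by
  have hd : Disjoint (span k {x}) (span k {y}) := by
    rw [disjoint_span_singleton, mem_span_singleton]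
    rintro ⟨a, ha⟩
    have := (LinearIndependent.pair_iff.1 h a (-1) (by rw [ha]; module)).2
    simp at this
  refine ⟨hd, codisjoint_iff.2 (eq_top_of_finrank_eq ?_)⟩
  rw [← span_insert, hX]
  rw [← Matrix.range_cons_cons_empty x y ![], finrank_span_eq_card h, Fintype.card_fin]

theorem exists_linearIndependent_pair [FiniteDimensional k X] (hX : 2 ≤ finrank k X) {x : X}
    (hx : x ≠ 0) : ∃ y, LinearIndependent k ![x, y] := by
  obtain ⟨y, hy⟩ := exists_linearIndependent_pair_of_one_lt_finrank hX hx
  exact ⟨y, hy⟩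

theorem exists_notMem_of_finrank_lt [FiniteDimensional k Y] {P : Submodule k Y}
    (h : finrank k P < finrank k Y) : ∃ y, y ∉ P := by
  by_contra! hc
  rw [eq_top_iff'.2 hc, finrank_top] at h
  exact lt_irrefl _ h

/-! ### Neighbours of codimension one; dimensions (1,n), (2,2) and (2,4) -/

/-- `f` has an indecomposable subrepresentation or quotient of codimension one. -/
def HasIndecomposableNeighbor (f : X →ₗ[k] V →ₗ[k] Y) : Prop :=
  (∃ P : Submodule k X, finrank k P + 1 = finrank k X ∧ Indecomposable (restrict f P)) ∨
    ∃ Q : Submodule k Y, finrank k Q = 1 ∧ Indecomposable (quotient f Q)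

/-- Any line of `Y` can be factored out: a one-dimensional source has no independent pairs, and
generation passes to quotients. -/
theorem Indecomposable.hasIndecomposableNeighbor_of_finrank_eq_one [FiniteDimensional k X]
    [FiniteDimensional k Y] (hf : Indecomposable f) (hX : finrank k X = 1)
    (hY : 1 ≤ finrank k Y) : HasIndecomposableNeighbor f := by
  have : Nontrivial X := nontrivial_of_finrank_pos (R := k) (by omega)
  have : Nontrivial Y := nontrivial_of_finrank_pos (R := k) (by omega)
  obtain ⟨y, hy⟩ := exists_ne (0 : Y)
  refine .inr ⟨span k {y}, finrank_span_singleton hy, indecomposable_quotient hf.image_top _ ?_⟩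
  intro x x' h
  have := h.fintype_card_le_finrank
  simp [hX] at this

theorem Indecomposable.finrank_add_one_le [FiniteDimensional k X] [FiniteDimensional k Y]
    (hf : Indecomposable f) (hX : finrank k X = 2) {x y : X} (h : LinearIndependent k ![x, y]) :
    finrank k Y + 1 ≤
      finrank k (LinearMap.range (f x)) + finrank k (LinearMap.range (f y)) := by
  have := hf.finrank_image_add (isCompl_span_singleton hX h)
    (by simpa using h.ne_zero 0) (by simpa using h.ne_zero 1)
  rwa [image_span_singleton, image_span_singleton] at this

theorem hasIndecomposableNeighbor_of_range_eq_top [FiniteDimensional k X]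
    (hX : finrank k X = 2) {x : X} (hx : x ≠ 0) (h : LinearMap.range (f x) = ⊤) :
    HasIndecomposableNeighbor f :=
  .inl ⟨span k {x}, by rw [finrank_span_singleton hx, hX],
    indecomposable_restrict_span_singleton hx h⟩

/-- Two independent vectors have ranks with sum at least 3, so one of them has full image and spans
the required hyperplane. -/
theorem Indecomposable.hasIndecomposableNeighbor_two_two [FiniteDimensional k X]
    [FiniteDimensional k Y] (hf : Indecomposable f) (hX : finrank k X = 2)
    (hY : finrank k Y = 2) : HasIndecomposableNeighbor f := by
  have : Nontrivial X := nontrivial_of_finrank_pos (R := k) (by omega)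
  obtain ⟨x, hx⟩ := exists_ne (0 : X)
  obtain ⟨y, hxy⟩ := exists_linearIndependent_pair hX.ge hx
  have h := hf.finrank_add_one_le hX hxy
  have h₁ := finrank_le (LinearMap.range (f x))
  have h₂ := finrank_le (LinearMap.range (f y))
  by_cases hr : finrank k (LinearMap.range (f x)) = 2
  · exact hasIndecomposableNeighbor_of_range_eq_top hX hx
      (eq_top_of_finrank_eq (by rw [hr, hY]))
  · exact hasIndecomposableNeighbor_of_range_eq_top hX (x := y) (hxy.ne_zero 1)
      (eq_top_of_finrank_eq (by omega))

/-- Ranks are at most 3 and add up to at least 5 on independent vectors, so they are at least 2,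
with equality on at most one line of `X`. Factoring out a vector outside that exceptional image
keeps all ranks at least 2 in a three-dimensional quotient. -/
theorem Indecomposable.hasIndecomposableNeighbor_two_four [FiniteDimensional k X]
    [FiniteDimensional k Y] [FiniteDimensional k V] (hf : Indecomposable f)
    (hV : finrank k V ≤ 3) (hX : finrank k X = 2)
    (hY : finrank k Y = 4) : HasIndecomposableNeighbor f := by
  have : Nontrivial X := nontrivial_of_finrank_pos (R := k) (by omega)
  have : Nontrivial Y := nontrivial_of_finrank_pos (R := k) (by omega)
  have hle (x : X) : finrank k (LinearMap.range (f x)) ≤ 3 := (LinearMap.finrank_range_le _).trans hV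
  have hge (x : X) (hx : x ≠ 0) : 2 ≤ finrank k (LinearMap.range (f x)) := by
    obtain ⟨y, hxy⟩ := exists_linearIndependent_pair hX.ge hx
    have := hf.finrank_add_one_le hX hxy
    have := hle y
    omega
  obtain ⟨y₀, hy₀, hy⟩ : ∃ y₀ : Y, y₀ ≠ 0 ∧ ∀ x : X, x ≠ 0 →
      finrank k (LinearMap.range (f x)) ≤ 2 → y₀ ∉ LinearMap.range (f x) := by
    by_cases h : ∃ x₀ : X, x₀ ≠ 0 ∧ finrank k (LinearMap.range (f x₀)) ≤ 2
    · obtain ⟨x₀, hx₀, h₂⟩ := h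
      obtain ⟨y₀, hy₀⟩ := exists_notMem_of_finrank_lt
        (P := LinearMap.range (f x₀)) (h₂.trans_lt (by omega))
      refine ⟨y₀, fun h0 => hy₀ (h0 ▸ zero_mem _), fun x hx hr => ?_⟩
      by_cases hli : LinearIndependent k ![x₀, x]
      · have := hf.finrank_add_one_le hX hli
        omega
      · rw [LinearIndependent.pair_iff' hx₀] at hli
        push Not at hli
        obtain ⟨a, rfl⟩ := hli
        rwa [range_smul (left_ne_zero_of_smul hx)]
    · push Not at h
      obtain ⟨y₀, hy₀⟩ := exists_ne (0 : Y)
      exact ⟨y₀, hy₀, fun x hx hr => absurd hr (h x hx).not_ge⟩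
  have hquot (x : X) (hx : x ≠ 0) :
      2 ≤ finrank k ((LinearMap.range (f x)).map (span k {y₀}).mkQ) := by
    by_cases hr : finrank k (LinearMap.range (f x)) ≤ 2
    · rw [finrank_map_mkQ_of_notMem (hy x hx hr)]
      exact hge x hx
    · have := finrank_le_finrank_map_mkQ_add_one (LinearMap.range (f x)) y₀
      omega
  refine .inr ⟨span k {y₀}, finrank_span_singleton hy₀, indecomposable_quotient hf.image_top _ ?_⟩
  intro x y hxy
  apply not_disjoint_of_finrank_lt
  have := hquot x (hxy.ne_zero 0)
  have := hquot y (hxy.ne_zero 1)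
  have := finrank_quotient_span_singleton_add_one (k := k) hy₀
  omega

/-! ### Dimension (2,3) -/

/-- Over an infinite field, every endomorphism becomes surjective after adding a suitable scalar. -/
theorem exists_smul_id_add_surjective [Infinite k] [FiniteDimensional k Y] (h : Y →ₗ[k] Y) :
    ∃ t : k, Function.Surjective (t • LinearMap.id + h : Y →ₗ[k] Y) := by
  obtain ⟨t, ht⟩ := (Module.End.finite_spectrum h).exists_notMem
  rw [spectrum.notMem_iff, Module.End.isUnit_iff] at ht
  refine ⟨-t, fun y => ?_⟩
  obtain ⟨x, hx⟩ := ht.surjective (-y)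
  refine ⟨x, ?_⟩
  rw [← neg_eq_iff_eq_neg] at hx
  rw [← hx]
  simp [Module.algebraMap_end_apply]
  abel

/-- A quotient criterion in dimension `(2, 3)`, when all nonzero vectors have two-dimensional
image. -/
theorem hasIndecomposableNeighbor_two_three_of_unique [FiniteDimensional k X]
    [FiniteDimensional k Y] (hf : Indecomposable f) (hX : finrank k X = 2)
    (hY : finrank k Y = 3)
    (hr : ∀ x : X, x ≠ 0 → finrank k (LinearMap.range (f x)) = 2) {y : Y} (hy : y ≠ 0)
    (h : ∀ x x' : X, LinearIndependent k ![x, x'] → y ∈ LinearMap.range (f x) →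
      y ∉ LinearMap.range (f x')) : HasIndecomposableNeighbor f := by
  have : Nontrivial X := nontrivial_of_finrank_pos (R := k) (by omega)
  refine .inr ⟨span k {y}, finrank_span_singleton hy, indecomposable_quotient hf.image_top _ ?_⟩
  intro x x' hli
  apply not_disjoint_of_finrank_lt
  have h₁ := finrank_le_finrank_map_mkQ_add_one (LinearMap.range (f x)) y
  have h₂ := finrank_le_finrank_map_mkQ_add_one (LinearMap.range (f x')) y
  have h₃ := hr x (hli.ne_zero 0)
  have h₄ := hr x' (hli.ne_zero 1)
  have h₅ := finrank_quotient_span_singleton_add_one (k := k) hy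
  -- The quotient has dimension 2: one of the two images keeps rank 2 and the other keeps rank at
  -- least 1, so they meet.
  by_cases hm : y ∈ LinearMap.range (f x)
  · have := finrank_map_mkQ_of_notMem (h x x' hli hm)
    omega
  · have := finrank_map_mkQ_of_notMem hm
    omega

theorem image_eq_range_sup {x y : X} [FiniteDimensional k X] (hX : finrank k X = 2)
    (h : LinearIndependent k ![x, y]) :
    image f ⊤ = LinearMap.range (f x) ⊔ LinearMap.range (f y) := by
  rw [← (isCompl_span_singleton hX h).sup_eq_top, image_sup, image_span_singleton,
    image_span_singleton]

/-- If `C` kills `e₀` and no `t • e₀ + e₁` has full image, then `f e₁ C` lies in the image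
of `e₀`. -/
theorem mem_range_of_forall_mem_range [Infinite k] [FiniteDimensional k Y]
    (hY : finrank k Y = 3) {e₀ e₁ : X} {C : V} (h₀ : f e₀ C = 0)
    (hr₀ : finrank k (LinearMap.range (f e₀)) = 2)
    (hr : ∀ t : k, LinearMap.range (f (t • e₀ + e₁)) ≠ ⊤) :
    f e₁ C ∈ LinearMap.range (f e₀) := by
  by_contra hc
  -- the endomorphism projects onto the image of `e₀` along `f e₁ C` and applies a section of `f e₀`
  have hcompl : IsCompl (LinearMap.range (f e₀)) (span k {f e₁ C}) := by
    have hd := disjoint_span_singleton_of_notMem hc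
    have hne : f e₁ C ≠ 0 := fun h => hc (by simp [h])
    refine ⟨hd, codisjoint_iff.2 (eq_top_of_finrank_eq ?_)⟩
    have := finrank_sup_add_finrank_inf_eq (LinearMap.range (f e₀)) (span k {f e₁ C})
    rw [hd.eq_bot, finrank_bot, finrank_span_singleton hne] at this
    omega
  obtain ⟨s, hs⟩ := (f e₀).rangeRestrict.exists_rightInverse_of_surjective
    (LinearMap.range_rangeRestrict _)
  have hs' (y : LinearMap.range (f e₀)) : f e₀ (s y) = y :=
    congrArg Subtype.val (LinearMap.congr_fun hs y)
  let p := (LinearMap.range (f e₀)).projectionOnto (span k {f e₁ C}) hcompl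
  obtain ⟨t, ht⟩ := exists_smul_id_add_surjective (f e₁ ∘ₗ s ∘ₗ p)
  refine hr t (top_le_iff.1 fun y _ => ?_)
  obtain ⟨z, rfl⟩ := ht y
  have hz : z - p z ∈ span k {f e₁ C} := sub_projection_mem hcompl z
  obtain ⟨a, ha⟩ := mem_span_singleton.1 hz
  -- Since `e₀` kills `C`, this vector is sent by `t • e₀ + e₁` to `t • p z + f e₁ (s (p z)) + (t *
  -- a) • f e₁ C`, and the outer terms add up to `t • z`.
  refine ⟨s (p z) + (t * a) • C, ?_⟩
  have : z = p z + a • f e₁ C := by rw [ha]; abel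
  simp only [map_add, map_smul, LinearMap.add_apply, LinearMap.smul_apply, hs', h₀,
    LinearMap.coe_comp, Function.comp_apply, LinearMap.id_apply]
  nth_rewrite 3 [this]
  module

/-- The vector `f e₁ C` lies in every image of a nonzero `x`: clearly off the line of `e₀`, and on
it by `mem_range_of_forall_mem_range`. Two distinct planes of `Y` among the images meet in a line
only, so any vector off the line of `f e₁ C` can be factored out. -/
theorem Indecomposable.hasIndecomposableNeighbor_two_three_of_kernel [Infinite k]
    [FiniteDimensional k X] [FiniteDimensional k Y] (hf : Indecomposable f)
    (hX : finrank k X = 2) (hY : finrank k Y = 3)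
    (hr : ∀ x : X, x ≠ 0 → finrank k (LinearMap.range (f x)) = 2) {e₀ e₁ : X} {C : V}
    (he₀ : e₀ ≠ 0) (h₀ : f e₀ C = 0) (h₁ : f e₁ C ≠ 0) : HasIndecomposableNeighbor f := by
  have : Nontrivial X := nontrivial_of_finrank_pos (R := k) (by omega)
  have hli : LinearIndependent k ![e₀, e₁] := by
    rw [LinearIndependent.pair_iff' he₀]
    rintro a rfl
    simp [h₀] at h₁
  have hspan (x : X) : ∃ s t : k, x = s • e₀ + t • e₁ := by
    have : x ∈ span k {e₀} ⊔ span k {e₁} := by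
      rw [(isCompl_span_singleton hX hli).sup_eq_top]
      trivial
    rw [← span_insert, mem_span_pair] at this
    obtain ⟨s, t, h⟩ := this
    exact ⟨s, t, h.symm⟩
  have hmem (x : X) (hx : x ≠ 0) : f e₁ C ∈ LinearMap.range (f x) := by
    obtain ⟨s, t, rfl⟩ := hspan x
    by_cases ht : t = 0
    · subst ht
      rw [zero_smul, add_zero] at hx ⊢
      rw [range_smul (left_ne_zero_of_smul hx)]
      refine mem_range_of_forall_mem_range hY h₀ (hr e₀ he₀) fun a htop => ?_
      have hne : a • e₀ + e₁ ≠ 0 := fun h0 => by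
        have := (LinearIndependent.pair_iff.1 hli a 1 (by simpa using h0)).2
        simp at this
      have := hr _ hne
      rw [htop, finrank_top] at this
      omega
    · exact ⟨t⁻¹ • C, by simp [h₀, ht]⟩
  obtain ⟨y, hy⟩ := exists_notMem_of_finrank_lt (P := span k {f e₁ C}) (by
    rw [finrank_span_singleton h₁]
    omega)
  refine hasIndecomposableNeighbor_two_three_of_unique hf hX hY hr (y := y)
    (fun h => hy (by simp [h])) fun x x' hxx h h' => ?_
  have hx := hxx.ne_zero 0
  have hx' := hxx.ne_zero 1
  have hsup := finrank_sup_add_finrank_inf_eq (LinearMap.range (f x)) (LinearMap.range (f x'))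
  rw [← image_eq_range_sup hX hxx, hf.image_top, finrank_top, hr x hx, hr x' hx'] at hsup
  have hle : span k {f e₁ C} ≤ LinearMap.range (f x) ⊓ LinearMap.range (f x') :=
    (span_singleton_le_iff_mem _ _).2 ⟨hmem x hx, hmem x' hx'⟩
  -- Two planes generating a three-dimensional space meet in dimension 2 + 2 - 3 = 1.
  have heq := eq_of_le_of_finrank_eq hle (by rw [finrank_span_singleton h₁]; omega)
  exact hy (heq ▸ ⟨h, h'⟩)

theorem linearIndependent_of_span_eq_top [FiniteDimensional k Y]
    (hY : finrank k Y = 3) {a b c : Y} (h : span k {a, b, c} = ⊤) :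
    LinearIndependent k ![a, b, c] := by
  refine linearIndependent_of_top_le_span_of_card_eq_finrank ?_ (by simp [hY])
  rw [← h]
  apply span_mono
  rintro y (rfl | rfl | rfl)
  exacts [⟨0, rfl⟩, ⟨1, rfl⟩, ⟨2, rfl⟩]

/-- All nonzero `x` have the same kernel, so only two arrows `A`, `B` matter. A relation `f u A = f
w B` puts the representation in the normal form with basis `f u B`, `f u A`, `f w A` of `Y`, where
`f u B` lies in the image of no vector outside the line of `u`. -/
theorem Indecomposable.hasIndecomposableNeighbor_two_three_of_injective
    [FiniteDimensional k X] [FiniteDimensional k Y] (hf : Indecomposable f)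
    (hX : finrank k X = 2) (hY : finrank k Y = 3)
    (hr : ∀ x : X, x ≠ 0 → finrank k (LinearMap.range (f x)) = 2)
    (hker : ∀ (x x' : X) (C : V), x ≠ 0 → f x C = 0 → f x' C = 0) :
    HasIndecomposableNeighbor f := by
  have : Nontrivial X := nontrivial_of_finrank_pos (R := k) (by omega)
  obtain ⟨e₀, he₀⟩ := exists_ne (0 : X)
  let b : Basis (Fin 2) k (LinearMap.range (f e₀)) := finBasisOfFinrankEq _ _ (hr e₀ he₀)
  obtain ⟨A, hA⟩ := (b 0).2
  obtain ⟨B, hB⟩ := (b 1).2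
  have hAB (x : X) (hx : x ≠ 0) : LinearIndependent k ![f x A, f x B] := by
    rw [LinearIndependent.pair_iff]
    intro s t hst
    have h0 := hker x e₀ (s • A + t • B) hx (by simpa using hst)
    rw [map_add, map_smul, map_smul, hA, hB] at h0
    have := Fintype.linearIndependent_iff.1 b.linearIndependent ![s, t]
      (Subtype.ext (by simpa using h0))
    exact ⟨this 0, this 1⟩
  have hrange (x : X) (hx : x ≠ 0) : LinearMap.range (f x) = span k {f x A, f x B} := by
    symm
    apply eq_of_le_of_finrank_eq
    · rw [span_le]
      rintro y (rfl | rfl)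
      exacts [⟨A, rfl⟩, ⟨B, rfl⟩]
    · rw [hr x hx, ← Matrix.range_cons_cons_empty _ _ ![], finrank_span_eq_card (hAB x hx),
        Fintype.card_fin]
  -- The map `(u, w) ↦ f u A - f w B` goes from dimension 4 to dimension 3.
  obtain ⟨u, w, huw, hne⟩ : ∃ u w : X, f u A = f w B ∧ ¬ (u = 0 ∧ w = 0) := by
    let g : (X × X) →ₗ[k] Y := (f.flip A).coprod (-f.flip B)
    have : LinearMap.ker g ≠ ⊥ := LinearMap.ker_ne_bot_of_finrank_lt (by
      rw [finrank_prod, hX, hY]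
      omega)
    obtain ⟨⟨u, w⟩, hg, h0⟩ := exists_mem_ne_zero_of_ne_bot this
    refine ⟨u, w, ?_, fun h => h0 (by simp [h.1, h.2])⟩
    rw [LinearMap.mem_ker] at hg
    simpa [g, ← sub_eq_add_neg, sub_eq_zero] using hg
  have hu : u ≠ 0 := by
    rintro rfl
    have hw : w ≠ 0 := fun h => hne ⟨rfl, h⟩
    rw [map_zero, LinearMap.zero_apply] at huw
    exact (hAB w hw).ne_zero 1 huw.symm
  have hli : LinearIndependent k ![u, w] := by
    rw [LinearIndependent.pair_iff' hu]
    rintro a rfl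
    have := (LinearIndependent.pair_iff.1 (hAB u hu) 1 (-a) (by
      rw [huw, map_smul, LinearMap.smul_apply]
      module)).1
    simp at this
  have htop : span k {f u B, f u A, f w A} = ⊤ := by
    rw [← hf.image_top, image_eq_range_sup hX hli, hrange u hu, hrange w (hli.ne_zero 1),
      ← huw]
    simp only [span_insert]
    rw [sup_comm (span k {f u A}) (span k {f u B}), sup_comm (span k {f w A}), sup_assoc,
      ← sup_assoc (span k {f u A}), sup_idem]
  have hli₃ := linearIndependent_of_span_eq_top hY htop
  rw [Fintype.linearIndependent_iff] at hli₃
  have key (x : X) (hx : x ≠ 0) (hm : f u B ∈ LinearMap.range (f x)) : x ∈ span k {u} := by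
    have hx' : x ∈ span k {u} ⊔ span k {w} := by
      rw [(isCompl_span_singleton hX hli).sup_eq_top]
      trivial
    rw [← span_insert, mem_span_pair] at hx'
    obtain ⟨s, t, rfl⟩ := hx'
    rw [hrange _ hx, mem_span_pair] at hm
    obtain ⟨l, m, hlm⟩ := hm
    -- Coefficients of `l • f x A + m • f x B - f u B` for `x = s • u + t • w` in the basis `f u B`,
    -- `f u A`, `f w A`. If `t ≠ 0` they force `l = m = 0`, contradicting the first one.
    have h := hli₃ ![m * s - 1, l * s + m * t, l * t] (by
      simp only [map_add, map_smul, LinearMap.add_apply, LinearMap.smul_apply, ← huw] at hlm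
      simp only [Fin.sum_univ_three, Matrix.cons_val]
      rw [← sub_eq_zero] at hlm
      rw [← hlm]
      module)
    have h0 := h 0
    have h1 := h 1
    have h2 := h 2
    simp only [Matrix.cons_val] at h0 h1 h2
    have ht : t = 0 := by
      by_contra ht
      have hl := (mul_eq_zero.1 h2).resolve_right ht
      rw [hl, zero_mul, zero_add] at h1
      have hm := (mul_eq_zero.1 h1).resolve_right ht
      simp [hm] at h0
    rw [ht, zero_smul, add_zero]
    exact smul_mem _ _ (mem_span_singleton_self u)
  refine hasIndecomposableNeighbor_two_three_of_unique hf hX hY hr (y := f u B)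
    ((hAB u hu).ne_zero 1) fun x x' hxx h h' => ?_
  obtain ⟨a, rfl⟩ := mem_span_singleton.1 (key x (hxx.ne_zero 0) h)
  obtain ⟨c, rfl⟩ := mem_span_singleton.1 (key x' (hxx.ne_zero 1) h')
  have h := (LinearIndependent.pair_iff.1 hxx c (-a) (by module)).2
  exact hxx.ne_zero 0 (by simp [neg_eq_zero.1 h])

/-- Without a vector of full image, ranks are at most 2 and add up to at least 4 on independent
pairs, so all are exactly 2. The remaining split is whether the kernels of the nonzero vectors
coincide. -/
theorem Indecomposable.hasIndecomposableNeighbor_two_three [Infinite k]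
    [FiniteDimensional k X] [FiniteDimensional k Y] (hf : Indecomposable f)
    (hX : finrank k X = 2) (hY : finrank k Y = 3) : HasIndecomposableNeighbor f := by
  by_cases htop : ∃ x : X, x ≠ 0 ∧ LinearMap.range (f x) = ⊤
  · obtain ⟨x, hx, h⟩ := htop
    exact hasIndecomposableNeighbor_of_range_eq_top hX hx h
  push Not at htop
  have hle (x : X) (hx : x ≠ 0) : finrank k (LinearMap.range (f x)) ≤ 2 := by
    have := finrank_lt (lt_top_iff_ne_top.2 (htop x hx)).ne
    omega
  have hr (x : X) (hx : x ≠ 0) : finrank k (LinearMap.range (f x)) = 2 := by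
    obtain ⟨y, hxy⟩ := exists_linearIndependent_pair hX.ge hx
    have := hf.finrank_add_one_le hX hxy
    have := hle x hx
    have := hle y (hxy.ne_zero 1)
    omega
  by_cases hker : ∀ (x x' : X) (C : V), x ≠ 0 → f x C = 0 → f x' C = 0
  · exact hf.hasIndecomposableNeighbor_two_three_of_injective hX hY hr hker
  · push Not at hker
    obtain ⟨x, x', C, hx, h₀, h₁⟩ := hker
    exact hf.hasIndecomposableNeighbor_two_three_of_kernel hX hY hr hx h₀ h₁

/-! ### Dimension (3,3) -/

theorem finrank_span_pair {x y : X} (h : LinearIndependent k ![x, y]) :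
    finrank k (span k {x, y}) = 2 := by
  rw [← Matrix.range_cons_cons_empty x y ![], finrank_span_eq_card h, Fintype.card_fin]

theorem notMem_span_singleton_or {x y : X} (h : LinearIndependent k ![x, y]) (u : X) :
    x ∉ span k {u} ∨ y ∉ span k {u} := by
  by_contra! hc
  obtain ⟨a, rfl⟩ := mem_span_singleton.1 hc.1
  obtain ⟨c, rfl⟩ := mem_span_singleton.1 hc.2
  have h' := (LinearIndependent.pair_iff.1 h c (-a) (by module)).2
  exact h.ne_zero 0 (by simp [neg_eq_zero.1 h'])

theorem linearIndependent_pair_of_notMem {P : Submodule k X} {x y : X} (hx : x ∈ P) (hx0 : x ≠ 0)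
    (hy : y ∉ P) : LinearIndependent k ![x, y] := by
  rw [LinearIndependent.pair_iff' hx0]
  rintro a rfl
  exact hy (P.smul_mem a hx)

theorem isCompl_span_singleton_of_notMem [FiniteDimensional k X] {P : Submodule k X} {x : X}
    (hP : finrank k P + 1 = finrank k X) (hx : x ∉ P) : IsCompl P (span k {x}) := by
  have hd := disjoint_span_singleton_of_notMem hx
  refine ⟨hd, codisjoint_iff.2 (eq_top_of_finrank_eq ?_)⟩
  have := finrank_sup_add_finrank_inf_eq P (span k {x})
  rw [hd.eq_bot, finrank_bot, finrank_span_singleton (fun h => hx (by simp [h]))] at this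
  omega

theorem eq_span_singleton_of_finrank_le_one [FiniteDimensional k Y] {R : Submodule k Y} {y : Y}
    (hR : finrank k R ≤ 1) (hy : y ∈ R) (hy0 : y ≠ 0) : R = span k {y} := by
  symm
  apply eq_of_le_of_finrank_le ((span_singleton_le_iff_mem _ _).2 hy)
  rwa [finrank_span_singleton hy0]

/-- A vector with zero image would split off as a simple summand. -/
theorem Indecomposable.range_ne_bot [FiniteDimensional k X] (hf : Indecomposable f)
    (hX : 2 ≤ finrank k X) {x : X} (hx : x ≠ 0) : LinearMap.range (f x) ≠ ⊥ := by
  intro h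
  obtain ⟨Q, hQ⟩ := Submodule.exists_isCompl (span k {x})
  refine hf.not_disjoint_image hQ (by simpa using hx) ?_ ?_
  · rintro rfl
    have := finrank_span_singleton_le (k := k) x
    rw [show span k {x} = ⊤ by simpa using hQ.sup_eq_top, finrank_top] at this
    omega
  · rw [image_span_singleton, h]
    exact disjoint_bot_left

/-- A plane spanned by a vector with nonzero image and vectors with full image is
indecomposable. -/
theorem hasIndecomposableNeighbor_of_pair [Nontrivial Y] (hX : finrank k X = 3)
    {p w : X} (h : LinearIndependent k ![p, w]) (hp : LinearMap.range (f p) ≠ ⊥)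
    (hw : ∀ t : k, LinearMap.range (f (w + t • p)) = ⊤) : HasIndecomposableNeighbor f := by
  -- Off the line of `p`, vectors of the plane are nonzero multiples of some `w + t • p`.
  have htop : ∀ x ∈ span k {p, w}, x ∉ span k {p} → LinearMap.range (f x) = ⊤ := by
    intro x hx hxp
    obtain ⟨s, t, rfl⟩ := mem_span_pair.1 hx
    have ht : t ≠ 0 := by
      rintro rfl
      exact hxp (mem_span_singleton.2 ⟨s, by simp⟩)
    rw [← hw (t⁻¹ * s), ← range_smul ht (w + _)]
    congr 2
    rw [smul_add, smul_smul, mul_inv_cancel_left₀ ht, add_comm]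
  have hbot : ∀ x ∈ span k {p, w}, x ≠ 0 → LinearMap.range (f x) ≠ ⊥ := by
    intro x hx hx0
    by_cases hxp : x ∈ span k {p}
    · obtain ⟨a, rfl⟩ := mem_span_singleton.1 hxp
      rwa [range_smul (left_ne_zero_of_smul hx0)]
    · rw [htop x hx hxp]
      exact top_ne_bot
  have hw0 : LinearMap.range (f w) = ⊤ := by simpa using hw 0
  refine .inl ⟨span k {p, w}, by rw [finrank_span_pair h, hX], indecomposable_restrict ?_ ?_ ?_⟩
  · exact ne_bot_of_le_ne_bot (b := span k {p}) (by simpa using h.ne_zero 0)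
      (span_mono (by simp))
  · rw [image_span_pair, hw0, sup_top_eq]
  · intro x hx y hy hxy hd
    rcases notMem_span_singleton_or hxy p with hn | hn
    · rw [htop x hx hn, top_disjoint] at hd
      exact hbot y hy (hxy.ne_zero 1) hd
    · rw [htop y hy hn, disjoint_top] at hd
      exact hbot x hx (hxy.ne_zero 0) hd

theorem hasIndecomposableNeighbor_of_plane [FiniteDimensional k Y] (hX : finrank k X = 3)
    (hY : finrank k Y = 3) {P : Submodule k X} (hP : finrank k P = 2) (htop : image f P = ⊤)
    (hr : ∀ x ∈ P, x ≠ 0 → 2 ≤ finrank k (LinearMap.range (f x))) :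
    HasIndecomposableNeighbor f := by
  refine .inl ⟨P, by rw [hP, hX], indecomposable_restrict ?_ htop ?_⟩
  · rintro rfl
    simp at hP
  · intro x hx y hy hxy
    apply not_disjoint_of_finrank_lt
    have := hr x hx (hxy.ne_zero 0)
    have := hr y hy (hxy.ne_zero 1)
    omega

/-- Otherwise `X` has a basis of vectors of rank at most one; splitting it as two plus one gives
images of total dimension at most 3, short of the required 4. -/
theorem Indecomposable.span_finrank_range_le_one_ne_top [FiniteDimensional k X]
    [FiniteDimensional k Y] (hf : Indecomposable f) (hX : finrank k X = 3)
    (hY : finrank k Y = 3) :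
    span k {x : X | finrank k (LinearMap.range (f x)) ≤ 1} ≠ ⊤ := by
  intro hS
  have hfin : finrank k (span k {x : X | finrank k (LinearMap.range (f x)) ≤ 1}) = 3 := by
    rw [hS, finrank_top, hX]
  have := exists_fun_fin_finrank_span_eq k {x : X | finrank k (LinearMap.range (f x)) ≤ 1}
  rw [hfin] at this
  obtain ⟨e, he, -, hli⟩ := this
  have h12 : LinearIndependent k ![e 1, e 2] := by
    rw [LinearIndependent.pair_iff]
    intro s t hst
    have := Fintype.linearIndependent_iff.1 hli ![0, s, t] (by simpa [Fin.sum_univ_three] using hst)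
    exact ⟨this 1, this 2⟩
  have h0 : e 0 ∉ span k {e 1, e 2} := by
    intro hm
    obtain ⟨s, t, hst⟩ := mem_span_pair.1 hm
    have := Fintype.linearIndependent_iff.1 hli ![-1, s, t] (by
      simp only [Fin.sum_univ_three, Matrix.cons_val, ← hst]
      module) 0
    simp at this
  have hle := hf.finrank_image_add (isCompl_span_singleton_of_notMem
    (by rw [finrank_span_pair h12, hX]) h0)
    (fun h => by have := finrank_span_pair h12; rw [h, finrank_bot] at this; omega)
    (by simpa using hli.ne_zero 0)
  rw [image_span_singleton, image_span_pair] at hle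
  have := finrank_add_le_finrank_add_finrank (LinearMap.range (f (e 1))) (LinearMap.range (f (e 2)))
  have h₀ : finrank k (LinearMap.range (f (e 0))) ≤ 1 := he 0
  have h₁ : finrank k (LinearMap.range (f (e 1))) ≤ 1 := he 1
  have h₂ : finrank k (LinearMap.range (f (e 2))) ≤ 1 := he 2
  omega

theorem exists_le_finrank_add_one [FiniteDimensional k X] {P : Submodule k X} (hP : P ≠ ⊤) :
    ∃ Q : Submodule k X, P ≤ Q ∧ finrank k Q + 1 = finrank k X := by
  obtain ⟨x, -, hx⟩ := SetLike.exists_of_lt (lt_top_iff_ne_top.2 hP)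
  obtain ⟨Q, hle, hQ⟩ := (disjoint_span_singleton_of_notMem hx).exists_isCompl
  refine ⟨Q, hle, ?_⟩
  have := finrank_add_eq_of_isCompl hQ
  rwa [finrank_span_singleton (fun h => hx (by simp [h]))] at this

/-- For `w ∉ P` every nonzero vector of the plane of `p` and `w` has rank at least 2, so that plane
works if its image is `Y`. If this fails for every `w`, all images from outside `P` lie in that of
`p`; these `w` generate `X`, so `p` itself has full image, a contradiction. -/
theorem Indecomposable.hasIndecomposableNeighbor_of_mem_plane [FiniteDimensional k X]
    [FiniteDimensional k Y] (hf : Indecomposable f) (hX : finrank k X = 3)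
    (hY : finrank k Y = 3) {P : Submodule k X} (hP : finrank k P = 2)
    (hPr : ∀ x, finrank k (LinearMap.range (f x)) ≤ 1 → x ∈ P) {p : X} (hp : p ∈ P) (hp0 : p ≠ 0)
    (hr : 2 ≤ finrank k (LinearMap.range (f p))) : HasIndecomposableNeighbor f := by
  have : Nontrivial X := nontrivial_of_finrank_pos (R := k) (by omega)
  by_contra hno
  have hne (w : X) (hw : w ∉ P) : image f (span k {p, w}) ≠ ⊤ := by
    intro htop
    refine hno (hasIndecomposableNeighbor_of_plane hX hY
      (finrank_span_pair (linearIndependent_pair_of_notMem hp hp0 hw)) htop fun x hx hx0 => ?_)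
    by_contra! hlt
    have hxP := hPr x (by omega)
    obtain ⟨s, t, rfl⟩ := mem_span_pair.1 hx
    have ht : t = 0 := by
      by_contra ht
      rw [P.add_mem_iff_right (P.smul_mem s hp), P.smul_mem_iff ht] at hxP
      exact hw hxP
    rw [ht, zero_smul, add_zero] at hx0 hlt
    rw [range_smul (left_ne_zero_of_smul hx0)] at hlt
    omega
  have hle (w : X) (hw : w ∉ P) : LinearMap.range (f w) ≤ LinearMap.range (f p) := by
    have hlt := finrank_lt (hne w hw)
    rw [image_span_pair] at hlt
    have := eq_of_le_of_finrank_le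
      (le_sup_left : LinearMap.range (f p) ≤ LinearMap.range (f p) ⊔ LinearMap.range (f w))
      (by omega)
    rw [this]
    exact le_sup_right
  obtain ⟨w, hw⟩ := exists_notMem_of_finrank_lt (P := P) (by omega)
  have htop : LinearMap.range (f p) = ⊤ := by
    rw [← top_le_iff, ← hf.image_top, image_le]
    intro x _ v
    by_cases hx : x ∈ P
    · have h₁ := hle w hw ⟨v, rfl⟩
      have h₂ := hle (w + x) (by rwa [P.add_mem_iff_left hx]) ⟨v, rfl⟩
      simpa using sub_mem h₂ h₁
    · exact hle x hx ⟨v, rfl⟩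
  exact hne w hw (by rw [image_span_pair, htop, top_sup_eq])

theorem exists_span_pair_eq [FiniteDimensional k X] {P : Submodule k X} (hP : finrank k P = 2)
    {p : X} (hp : p ∈ P) (hp0 : p ≠ 0) :
    ∃ q ∈ P, LinearIndependent k ![p, q] ∧ span k {p, q} = P := by
  obtain ⟨q, hq⟩ := exists_linearIndependent_pair hP.ge (x := ⟨p, hp⟩)
    (fun h => hp0 (congrArg Subtype.val h))
  have hli : LinearIndependent k ![p, (q : X)] := by
    rw [LinearIndependent.pair_iff] at hq ⊢
    exact fun s t hst => hq s t (Subtype.ext (by simpa using hst))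
  refine ⟨q, q.2, hli, eq_of_le_of_finrank_eq ?_ (by rw [finrank_span_pair hli, hP])⟩
  rw [span_le]
  rintro x (rfl | rfl)
  exacts [hp, q.2]

/-- A plane of vectors whose images lie in a common line. -/
theorem Indecomposable.hasIndecomposableNeighbor_of_range_eq [FiniteDimensional k X]
    [FiniteDimensional k Y] (hf : Indecomposable f) (hX : finrank k X = 3)
    (hY : finrank k Y = 3) {e₀ e₁ : X} (hli : LinearIndependent k ![e₀, e₁])
    (hr : finrank k (LinearMap.range (f e₀)) ≤ 1)
    (h : LinearMap.range (f e₀) = LinearMap.range (f e₁)) : HasIndecomposableNeighbor f := by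
  have : Nontrivial Y := nontrivial_of_finrank_pos (R := k) (by omega)
  have hP := finrank_span_pair hli
  -- The plane has an image of dimension at most one, so its complement must contribute at least 3.
  have htop (w : X) (hw : w ∉ span k {e₀, e₁}) : LinearMap.range (f w) = ⊤ := by
    have hle := hf.finrank_image_add (isCompl_span_singleton_of_notMem (by rw [hP, hX]) hw)
      (fun h => by rw [h, finrank_bot] at hP; omega)
      (by simpa using fun h => hw (by simp [h]))
    rw [image_span_singleton, image_span_pair, ← h, sup_idem] at hle
    have := finrank_le (LinearMap.range (f w))
    exact eq_top_of_finrank_eq (by omega)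
  have hmem : e₀ ∈ span k {e₀, e₁} := subset_span (by simp)
  obtain ⟨w, hw⟩ := exists_notMem_of_finrank_lt (P := span k {e₀, e₁}) (by omega)
  refine hasIndecomposableNeighbor_of_pair hX
    (linearIndependent_pair_of_notMem hmem (hli.ne_zero 0) hw)
    (hf.range_ne_bot (by omega) (hli.ne_zero 0)) fun t => htop _ ?_
  rwa [Submodule.add_mem_iff_left _ (smul_mem _ t hmem)]

/-- Linear combinations of two rank one maps with distinct images can only all have rank at most
one if the kernels agree. -/
theorem ker_le_ker_of_range_ne [FiniteDimensional k X] [FiniteDimensional k Y] {e₀ e₁ : X}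
    (h₀ : finrank k (LinearMap.range (f e₀)) = 1) (h₁ : finrank k (LinearMap.range (f e₁)) = 1)
    (hsum : finrank k (LinearMap.range (f (e₀ + e₁))) ≤ 1)
    (hne : LinearMap.range (f e₀) ≠ LinearMap.range (f e₁)) {C : V} (hC : f e₀ C = 0) :
    f e₁ C = 0 := by
  by_contra hC₁
  have hr₁ := eq_span_singleton_of_finrank_le_one h₁.le ⟨C, rfl⟩ hC₁
  have hr := eq_span_singleton_of_finrank_le_one hsum ⟨C, by simp [hC]⟩ hC₁
  refine hne (eq_of_le_of_finrank_eq ?_ (by rw [h₀, h₁]))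
  rintro _ ⟨B, rfl⟩
  -- As `f e₀ C = 0`, the vector `f e₁ C` spans the images of both `e₁` and `e₀ + e₁`; hence the
  -- image of `e₀` lies in the same line.
  have hB : f (e₀ + e₁) B ∈ LinearMap.range (f e₁) := by
    rw [hr₁, ← hr]
    exact ⟨B, rfl⟩
  simpa using sub_mem hB ⟨B, rfl⟩

/-- A plane `P` of vectors of rank one with a common kernel `K`. -/
theorem Indecomposable.hasIndecomposableNeighbor_of_common_kernel [FiniteDimensional k X]
    [FiniteDimensional k Y] (hf : Indecomposable f) (hX : finrank k X = 3)
    (hY : finrank k Y = 3) {P : Submodule k X} (hP : finrank k P = 2)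
    (hPr : ∀ x, finrank k (LinearMap.range (f x)) ≤ 1 → x ∈ P) {K : Submodule k V} {A : V}
    (hK : K ⊔ span k {A} = ⊤) (hPK : ∀ p ∈ P, ∀ C ∈ K, f p C = 0)
    (hPA : ∀ p ∈ P, f p A = 0 → p = 0) : HasIndecomposableNeighbor f := by
  have : Nontrivial X := nontrivial_of_finrank_pos (R := k) (by omega)
  have : Nontrivial Y := nontrivial_of_finrank_pos (R := k) (by omega)
  have hrange (x : X) : LinearMap.range (f x) = K.map (f x) ⊔ span k {f x A} := by
    rw [LinearMap.range_eq_map, ← hK, Submodule.map_sup, map_span, Set.image_singleton]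
  have hrangeP {p : X} (hp : p ∈ P) : LinearMap.range (f p) = span k {f p A} := by
    rw [hrange, sup_eq_right]
    rintro _ ⟨C, hC, rfl⟩
    rw [hPK p hp C hC]
    exact zero_mem _
  obtain ⟨w, hw⟩ := exists_notMem_of_finrank_lt (P := P) (by omega)
  -- Since `P` kills `K`, the space `D` of images of `K` depends on `w` only modulo `P`.
  have hmap {p : X} (hp : p ∈ P) : K.map (f (w + p)) = K.map (f w) := by
    ext y
    simp only [mem_map]
    refine exists_congr fun C => and_congr_right fun hC => ?_
    rw [map_add, LinearMap.add_apply, hPK p hp C hC, add_zero]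
  set D := K.map (f w) with hD
  set R := P.map (f.flip A) with hR
  have hRdim : finrank k R = 2 := by
    have hinj : Function.Injective ((f.flip A).domRestrict P) := by
      rw [← LinearMap.ker_eq_bot, LinearMap.ker_eq_bot']
      exact fun p hp => Subtype.ext (hPA p p.2 hp)
    rw [← hP, ← LinearMap.finrank_range_of_inj hinj, LinearMap.range_domRestrict]
  have htop : R ⊔ (D ⊔ span k {f w A}) = ⊤ := by
    rw [← hf.image_top, ← (isCompl_span_singleton_of_notMem (by omega) hw).sup_eq_top, image_sup,
      image_span_singleton, hrange w]
    congr 1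
    apply le_antisymm
    · rintro _ ⟨p, hp, rfl⟩
      exact apply_mem_image hp A
    · refine image_le.2 fun p hp v => ?_
      have : f p v ∈ span k {f p A} := hrangeP hp ▸ ⟨v, rfl⟩
      exact (span_singleton_le_iff_mem _ _).2 (show f p A ∈ R from ⟨p, hp, rfl⟩) this
  -- If `D` is large it meets the plane `R`, say in `f p A`. Adding multiples of `p` to a vector of
  -- full image outside `P` then changes its value at `A` only within `D`, so the image stays full.
  by_cases hDdim : 2 ≤ finrank k D
  · have hnd : ¬ Disjoint D R := not_disjoint_of_finrank_lt (by omega)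
    obtain ⟨_, ⟨hpD, p, hp, rfl⟩, hp0⟩ := exists_mem_ne_zero_of_ne_bot (mt disjoint_iff.2 hnd)
    have hp0' : p ≠ 0 := by
      rintro rfl
      simp at hp0
    obtain ⟨p', hp', htop'⟩ : ∃ p' ∈ P, D ⊔ span k {f (w + p') A} = ⊤ := by
      have hmax (y : Y) (hy : y ∉ D) : D ⊔ span k {y} = ⊤ := by
        have hlt := finrank_lt_finrank_of_lt (lt_sup_iff_notMem.2 hy)
        have := finrank_le (D ⊔ span k {y})
        exact eq_top_of_finrank_eq (by omega)
      by_contra! hc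
      have hall (p' : X) (hp' : p' ∈ P) : f (w + p') A ∈ D := by
        by_contra hn
        exact hc p' hp' (hmax _ hn)
      have hwD : f w A ∈ D := by simpa using hall 0 (zero_mem _)
      have hRD : R ≤ D := by
        rintro _ ⟨q, hq, rfl⟩
        simpa using sub_mem (hall q hq) hwD
      refine hc 0 (zero_mem _) ?_
      rwa [← sup_assoc, sup_eq_right.2 hRD, ← add_zero w] at htop
    have hwp' : w + p' ∉ P := by rwa [P.add_mem_iff_left hp']
    refine hasIndecomposableNeighbor_of_pair hX (linearIndependent_pair_of_notMem hp hp0' hwp')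
      (hf.range_ne_bot (by omega) hp0') fun t => ?_
    rw [hrange, add_assoc, hmap (add_mem hp' (P.smul_mem t hp)), ← htop']
    apply le_antisymm
    · rw [htop']
      exact le_top
    · refine sup_le le_sup_left ((span_singleton_le_iff_mem _ _).2 ?_)
      have h₁ : f (w + (p' + t • p)) A ∈ D ⊔ span k {f (w + (p' + t • p)) A} :=
        mem_sup_right (mem_span_singleton_self _)
      have h₂ : t • f p A ∈ D ⊔ span k {f (w + (p' + t • p)) A} :=
        mem_sup_left (D.smul_mem t hpD)
      have := sub_mem h₁ h₂
      convert this using 1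
      simp only [map_add, map_smul, LinearMap.add_apply, LinearMap.smul_apply]
      abel
  exfalso
  -- With `dim D ≤ 1` there is no such `f`. If `D` lies in the line of `f p A`, splitting `X` into
  -- the plane of `p`, `w` and a line of `P` gives images of total dimension at most 2 + 1.
  by_cases hp : ∃ p ∈ P, p ≠ 0 ∧ D ≤ span k {f p A}
  · obtain ⟨p, hp, hp0, hDp⟩ := hp
    obtain ⟨q, hq, hpq, hspan⟩ := exists_span_pair_eq hP hp hp0
    have hpw := linearIndependent_pair_of_notMem hp hp0 hw
    have hqn : q ∉ span k {p, w} := by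
      intro hm
      obtain ⟨s, t, rfl⟩ := mem_span_pair.1 hm
      have ht : t = 0 := by
        by_contra ht
        rw [P.add_mem_iff_right (P.smul_mem s hp), P.smul_mem_iff ht] at hq
        exact hw hq
      have := (LinearIndependent.pair_iff.1 hpq s (-1) (by rw [ht]; module)).2
      simp at this
    have hle := hf.finrank_image_add (isCompl_span_singleton_of_notMem
      (by rw [finrank_span_pair hpw, hX]) hqn)
      (fun h => by have := finrank_span_pair hpw; rw [h, finrank_bot] at this; omega)
      (by simpa using hpq.ne_zero 1)
    rw [image_span_singleton, image_span_pair, hrangeP hp, hrangeP hq, hrange w, ← sup_assoc,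
      sup_eq_left.2 hDp] at hle
    have h₁ := finrank_add_le_finrank_add_finrank (span k {f p A}) (span k {f w A})
    have h₂ := finrank_span_singleton_le (k := k) (f p A)
    have h₃ := finrank_span_singleton_le (k := k) (f w A)
    have h₄ := finrank_span_singleton_le (k := k) (f q A)
    omega
  · push Not at hp
    obtain ⟨p₀, hp₀, hp₀0⟩ := exists_mem_ne_zero_of_ne_bot (p := P) (by
      rintro rfl
      simp at hP)
    obtain ⟨d, hd, hd0⟩ := exists_mem_ne_zero_of_ne_bot (p := D) (fun h => hp p₀ hp₀ hp₀0 (by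
      rw [h]
      exact bot_le))
    have hDd := eq_span_singleton_of_finrank_le_one (by omega) hd hd0
    have hdR : d ∉ R := by
      rintro ⟨p, hpP, rfl⟩
      refine hp p hpP ?_ hDd.le
      rintro rfl
      simp at hd0
    -- Here `Y = R ⊕ D`. Correcting `w` by the element of `P` that gives the `R`-component of `f w
    -- A` yields a vector outside `P` with image in the line `D`, contradicting `hPr`.
    have hmem : f w A ∈ R ⊔ span k {d} := by
      rw [(isCompl_span_singleton_of_notMem (by omega) hdR).sup_eq_top]
      trivial
    obtain ⟨_, ⟨p, hpP, rfl⟩, d', hd', hsum⟩ := mem_sup.1 hmem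
    rw [← hDd] at hd'
    have hle : LinearMap.range (f (w + -p)) ≤ D := by
      rw [hrange, hmap (neg_mem hpP)]
      refine sup_le le_rfl ((span_singleton_le_iff_mem _ _).2 ?_)
      rw [map_add, LinearMap.add_apply, ← hsum]
      simpa using hd'
    refine hw ((P.add_mem_iff_left (neg_mem hpP)).1 (hPr (w + -p) ?_))
    have := finrank_mono hle
    omega

/-- Choose a plane containing all vectors of rank at most one. If it has no vector of higher rank,
it is a linear space of rank one maps, and such a space has a common image or a common kernel. -/
theorem Indecomposable.hasIndecomposableNeighbor_three_three [FiniteDimensional k X]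
    [FiniteDimensional k Y] (hf : Indecomposable f) (hX : finrank k X = 3)
    (hY : finrank k Y = 3) : HasIndecomposableNeighbor f := by
  obtain ⟨P, hle, hP⟩ := exists_le_finrank_add_one (hf.span_finrank_range_le_one_ne_top hX hY)
  have hPr (x : X) (hx : finrank k (LinearMap.range (f x)) ≤ 1) : x ∈ P := hle (subset_span hx)
  have hP2 : finrank k P = 2 := by omega
  by_cases h2 : ∃ p ∈ P, p ≠ 0 ∧ 2 ≤ finrank k (LinearMap.range (f p))
  · obtain ⟨p, hp, hp0, hr⟩ := h2
    exact hf.hasIndecomposableNeighbor_of_mem_plane hX hY hP2 hPr hp hp0 hr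
  push Not at h2
  have hr (p : X) (hp : p ∈ P) (hp0 : p ≠ 0) : finrank k (LinearMap.range (f p)) = 1 := by
    have := h2 p hp hp0
    have : finrank k (LinearMap.range (f p)) ≠ 0 := fun h =>
      hf.range_ne_bot (by omega) hp0 (finrank_eq_zero.1 h)
    omega
  obtain ⟨e₀, he₀, he₀0⟩ := exists_mem_ne_zero_of_ne_bot (p := P) (by
    rintro rfl
    simp at hP2)
  obtain ⟨e₁, he₁, hli, hspan⟩ := exists_span_pair_eq hP2 he₀ he₀0
  have he₁0 : e₁ ≠ 0 := hli.ne_zero 1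
  by_cases heq : LinearMap.range (f e₀) = LinearMap.range (f e₁)
  · exact hf.hasIndecomposableNeighbor_of_range_eq hX hY hli (hr e₀ he₀ he₀0).le heq
  have hsum0 : e₀ + e₁ ≠ 0 := fun h => by
    simpa using (LinearIndependent.pair_iff.1 hli 1 1 (by simpa using h)).1
  have hker {C : V} (hC : f e₀ C = 0) : f e₁ C = 0 :=
    ker_le_ker_of_range_ne (hr e₀ he₀ he₀0) (hr e₁ he₁ he₁0)
      (hr _ (add_mem he₀ he₁) hsum0).le heq hC
  obtain ⟨_, ⟨A, rfl⟩, hA⟩ := exists_mem_ne_zero_of_ne_bot (hf.range_ne_bot (by omega) he₀0)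
  have hr₀ := eq_span_singleton_of_finrank_le_one (hr e₀ he₀ he₀0).le ⟨A, rfl⟩ hA
  have hdecomp (C : V) : ∃ c : k, f e₀ (C - c • A) = 0 := by
    have : f e₀ C ∈ span k {f e₀ A} := hr₀ ▸ ⟨C, rfl⟩
    obtain ⟨c, hc⟩ := mem_span_singleton.1 this
    exact ⟨c, by simp [hc]⟩
  have hA₁ : f e₁ A ≠ 0 := by
    intro h
    refine hf.range_ne_bot (by omega) he₁0 (eq_bot_iff.2 ?_)
    rintro _ ⟨C, rfl⟩
    obtain ⟨c, hc⟩ := hdecomp C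
    simpa [h] using hker hc
  have hr₁ := eq_span_singleton_of_finrank_le_one (hr e₁ he₁ he₁0).le ⟨A, rfl⟩ hA₁
  refine hf.hasIndecomposableNeighbor_of_common_kernel hX hY hP2 hPr
    (K := LinearMap.ker (f e₀)) (A := A) ?_ ?_ ?_
  · rw [eq_top_iff]
    intro C _
    obtain ⟨c, hc⟩ := hdecomp C
    rw [← sub_add_cancel C (c • A)]
    exact add_mem (mem_sup_left hc) (mem_sup_right (smul_mem _ _ (mem_span_singleton_self A)))
  · intro p hp C hC
    rw [← hspan] at hp
    obtain ⟨s, t, rfl⟩ := mem_span_pair.1 hp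
    simp [LinearMap.mem_ker.1 hC, hker hC]
  · intro p hp hpA
    rw [← hspan] at hp
    obtain ⟨s, t, rfl⟩ := mem_span_pair.1 hp
    have hnli : LinearIndependent k ![f e₀ A, f e₁ A] := by
      rw [LinearIndependent.pair_iff' hA]
      rintro a ha
      have ha0 : a ≠ 0 := by
        rintro rfl
        exact hA₁ (by simpa using ha.symm)
      exact heq (by rw [hr₀, hr₁, ← ha, span_singleton_smul_eq (IsUnit.mk0 a ha0)])
    have := LinearIndependent.pair_iff.1 hnli s t (by simpa using hpA)
    simp [this.1, this.2]

/-! ### Duality -/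

/-- The dual representation. -/
def dual (f : X →ₗ[k] V →ₗ[k] Y) : Dual k Y →ₗ[k] V →ₗ[k] Dual k X :=
  LinearMap.mk₂ k (fun η v => η ∘ₗ f.flip v) (fun _ _ _ => by ext; simp) (fun _ _ _ => by ext; simp)
    (fun _ _ _ => by ext; simp) (fun _ _ _ => by ext; simp)

theorem Indecomposable.congr {X' Y' : Type*} [AddCommGroup X'] [Module k X'] [AddCommGroup Y']
    [Module k Y'] {f' : X' →ₗ[k] V →ₗ[k] Y'} (hf : Indecomposable f) (eX : X ≃ₗ[k] X')
    (eY : Y ≃ₗ[k] Y') (h : ∀ x v, f' (eX x) v = eY (f x v)) : Indecomposable f' := by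
  refine ⟨fun hs => hf.1 ⟨@Equiv.subsingleton _ _ eX.toEquiv hs.1,
    @Equiv.subsingleton _ _ eY.toEquiv hs.2⟩, fun X₁ X₂ Y₁ Y₂ hX hY h₁ h₂ => ?_⟩
  let oX := (orderIsoMapComap eX).symm
  let oY := (orderIsoMapComap eY).symm
  have hmem {P : Submodule k X'} {Q : Submodule k Y'} (hPQ : ∀ x ∈ P, ∀ v, f' x v ∈ Q) :
      ∀ x ∈ oX P, ∀ v, f x v ∈ oY Q := by
    intro x hx v
    show eY (f x v) ∈ Q
    rw [← h]
    exact hPQ _ hx v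
  have := hf.2 (oX X₁) (oX X₂) (oY Y₁) (oY Y₂) (oX.isCompl hX) (oY.isCompl hY) (hmem h₁) (hmem h₂)
  simpa only [map_eq_bot_iff] using this

theorem eq_bot_of_dualAnnihilator_eq_bot {P Q : Submodule k X} (h : IsCompl P Q)
    (hQ : Q.dualAnnihilator = ⊥) : P = ⊥ := by
  rw [dualAnnihilator_eq_bot_iff] at hQ
  rw [hQ] at h
  simpa using h.inf_eq_bot

/-- Annihilators turn a decomposition of `f` into one of its dual. -/
theorem Indecomposable.of_dual [FiniteDimensional k X] [FiniteDimensional k Y]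
    (hf : Indecomposable (dual f)) : Indecomposable f := by
  refine ⟨fun ⟨h₁, h₂⟩ => hf.1 ⟨inferInstance, inferInstance⟩, fun X₁ X₂ Y₁ Y₂ hX hY h₁ h₂ => ?_⟩
  have hann {P : Submodule k X} {Q : Submodule k Y} (hPQ : ∀ x ∈ P, ∀ v, f x v ∈ Q) :
      ∀ η ∈ Q.dualAnnihilator, ∀ v, dual f η v ∈ P.dualAnnihilator := by
    intro η hη v
    rw [mem_dualAnnihilator] at hη ⊢
    exact fun x hx => hη _ (hPQ x hx v)
  rcases hf.2 _ _ _ _ (Subspace.isCompl_dualAnnihilator hY.symm)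
    (Subspace.isCompl_dualAnnihilator hX.symm) (hann h₂) (hann h₁) with h | h
  · exact .inl ⟨eq_bot_of_dualAnnihilator_eq_bot hX h.2, eq_bot_of_dualAnnihilator_eq_bot hY h.1⟩
  · exact .inr ⟨eq_bot_of_dualAnnihilator_eq_bot hX.symm h.2,
      eq_bot_of_dualAnnihilator_eq_bot hY.symm h.1⟩

theorem Indecomposable.dual [FiniteDimensional k X] [FiniteDimensional k Y]
    (hf : Indecomposable f) : Indecomposable (dual f) := by
  refine of_dual (hf.congr (evalEquiv k X) (evalEquiv k Y) fun x v => ?_)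
  ext η
  rfl

/-- A hyperplane of the dual of `Y` is the annihilator of a line of `Y`, and restricting to it
dualizes the quotient by that line; likewise a line in the dual of `X` corresponds to a hyperplane
of `X`. -/
theorem HasIndecomposableNeighbor.of_dual [FiniteDimensional k X] [FiniteDimensional k Y]
    (h : HasIndecomposableNeighbor (BilinearRep.dual f)) : HasIndecomposableNeighbor f := by
  rcases h with ⟨P, hP, h⟩ | ⟨Q, hQ, h⟩
  · right
    have hPQ : P.dualCoannihilator.dualAnnihilator = P :=
      Subspace.dualCoannihilator_dualAnnihilator_eq
    refine ⟨P.dualCoannihilator, ?_, .of_dual ?_⟩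
    · have := Subspace.finrank_add_finrank_dualCoannihilator_eq P
      rw [Subspace.dual_finrank_eq] at hP
      omega
    · refine h.congr ((LinearEquiv.ofEq _ _ hPQ.symm).trans
        (dualQuotEquivDualAnnihilator P.dualCoannihilator).symm) (.refl k _) fun η v => ?_
      rfl
  · left
    have hPQ : Q.dualCoannihilator.dualAnnihilator = Q :=
      Subspace.dualCoannihilator_dualAnnihilator_eq
    refine ⟨Q.dualCoannihilator, ?_, .of_dual ?_⟩
    · have := Subspace.finrank_add_finrank_dualCoannihilator_eq Q
      omega
    · refine h.congr (.refl k _) ((quotEquivOfEq _ _ hPQ.symm).trans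
        (Subspace.quotAnnihilatorEquiv Q.dualCoannihilator)) fun η v => ?_
      ext x
      simp
      rfl

/-! ### All dimension pairs together -/

theorem Indecomposable.finrank_le_one_of_finrank_eq_zero [FiniteDimensional k X]
    [FiniteDimensional k Y] (hf : Indecomposable f) (hX : finrank k X = 0) : finrank k Y ≤ 1 := by
  have : Subsingleton X := finrank_zero_iff.1 hX
  by_contra! hY
  have : Nontrivial Y := nontrivial_of_finrank_pos (R := k) (by omega)
  obtain ⟨y, hy⟩ := exists_ne (0 : Y)
  obtain ⟨Q, hQ⟩ := Submodule.exists_isCompl (span k {y})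
  rcases hf.2 ⊥ ⊤ (span k {y}) Q isCompl_bot_top hQ (by simp)
    (fun x _ v => by simp [Subsingleton.elim x 0]) with h | h
  · exact hy (by simpa using h.2)
  · have := finrank_add_eq_of_isCompl hQ
    rw [h.2, finrank_bot, finrank_span_singleton hy] at this
    omega

theorem Indecomposable.hasIndecomposableNeighbor_of_finrank_le [Infinite k]
    [FiniteDimensional k X] [FiniteDimensional k V] [FiniteDimensional k Y] (hf : Indecomposable f)
    (hV : finrank k V ≤ 3) (h₂ : 2 ≤ finrank k X + finrank k Y)
    (h₆ : finrank k X + finrank k Y ≤ 6) (hle : finrank k X ≤ finrank k Y) :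
    HasIndecomposableNeighbor f := by
  obtain hX | hX | hX | hX : finrank k X = 0 ∨ finrank k X = 1 ∨ finrank k X = 2 ∨
    finrank k X = 3 := by omega
  · have := hf.finrank_le_one_of_finrank_eq_zero hX
    omega
  · exact hf.hasIndecomposableNeighbor_of_finrank_eq_one hX (by omega)
  · obtain hY | hY | hY : finrank k Y = 2 ∨ finrank k Y = 3 ∨ finrank k Y = 4 := by omega
    · exact hf.hasIndecomposableNeighbor_two_two hX hY
    · exact hf.hasIndecomposableNeighbor_two_three hX hY
    · exact hf.hasIndecomposableNeighbor_two_four hV hX hY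
  · exact hf.hasIndecomposableNeighbor_three_three hX (by omega)

theorem Indecomposable.hasIndecomposableNeighbor [Infinite k]
    [FiniteDimensional k X] [FiniteDimensional k V] [FiniteDimensional k Y] (hf : Indecomposable f)
    (hV : finrank k V ≤ 3) (h₂ : 2 ≤ finrank k X + finrank k Y)
    (h₆ : finrank k X + finrank k Y ≤ 6) : HasIndecomposableNeighbor f := by
  rcases le_total (finrank k X) (finrank k Y) with h | h
  · exact hf.hasIndecomposableNeighbor_of_finrank_le hV h₂ h₆ h
  · refine .of_dual (hf.dual.hasIndecomposableNeighbor_of_finrank_le hV ?_ ?_ ?_) <;>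
      simp only [Subspace.dual_finrank_eq] <;> omega

end BilinearRep

/-! ### Kronecker representations as bilinear maps -/

namespace KroneckerRep

variable {n : ℕ} {k : Type u} [Field k]

/-- The bilinear map `M(x) × kⁿ → M(y)` given by the arrows. -/
noncomputable def bilin (M : KroneckerRep.{u, v} n k) : M.X →ₗ[k] (Fin n → k) →ₗ[k] M.Y :=
  (Fintype.linearCombination k M.map).flip

theorem bilin_apply (M : KroneckerRep.{u, v} n k) (x : M.X) (c : Fin n → k) :
    M.bilin x c = ∑ i, c i • M.map i x := by
  simp [bilin, Fintype.linearCombination_apply, LinearMap.sum_apply]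

theorem bilin_mem_iff (M : KroneckerRep.{u, v} n k) {P : Submodule k M.X} {Q : Submodule k M.Y} :
    (∀ x ∈ P, ∀ c, M.bilin x c ∈ Q) ↔ ∀ i, ∀ x ∈ P, M.map i x ∈ Q := by
  constructor
  · intro h i x hx
    simpa [bilin_apply, Pi.single_apply] using h x hx (Pi.single i 1)
  · intro h x hx c
    rw [bilin_apply]
    exact sum_mem fun i _ => Q.smul_mem _ (h i x hx)

/-- The subrepresentation of `M` on subspaces `P` and `Q`. -/
def sub (M : KroneckerRep.{u, v} n k) (P : Submodule k M.X) (Q : Submodule k M.Y)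
    (h : ∀ i, ∀ x ∈ P, M.map i x ∈ Q) : KroneckerRep.{u, v} n k where
  X := P
  Y := Q
  map i := (M.map i).restrict (h i)

/-- An internal decomposition of the bilinear map is preserved by each arrow, so it gives an
isomorphism with an external direct sum of subrepresentations. -/
theorem IsIndecomposable.bilin {M : KroneckerRep.{u, v} n k} (hM : M.IsIndecomposable) :
    BilinearRep.Indecomposable M.bilin := by
  refine ⟨hM.1, fun X₁ X₂ Y₁ Y₂ hX hY h₁ h₂ => ?_⟩
  rw [bilin_mem_iff] at h₁ h₂
  let eX := (prodEquivOfIsCompl X₁ X₂ hX).symm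
  let eY := (prodEquivOfIsCompl Y₁ Y₂ hY).symm
  have hcomm (i : Fin n) (x : M.X) : eY (M.map i x) =
      ((M.map i).restrict (h₁ i) (eX x).1, (M.map i).restrict (h₂ i) (eX x).2) := by
    obtain ⟨z, rfl⟩ := (prodEquivOfIsCompl X₁ X₂ hX).surjective x
    have hz : eX (prodEquivOfIsCompl X₁ X₂ hX z) = z := LinearEquiv.symm_apply_apply _ z
    rw [hz, LinearEquiv.symm_apply_eq, coe_prodEquivOfIsCompl', coe_prodEquivOfIsCompl', map_add]
    rfl
  have hiso : IsIso M ((M.sub X₁ Y₁ h₁).prod (M.sub X₂ Y₂ h₂)) :=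
    ⟨{ x := eX.toLinearMap
       y := eY.toLinearMap
       comm := fun i => LinearMap.ext (hcomm i) },
      ⟨eX.injective, eY.injective⟩, ⟨eX.surjective, eY.surjective⟩⟩
  rcases hM.2 _ _ hiso with h | h
  · exact .inl ⟨subsingleton_iff_eq_bot.1 h.1, subsingleton_iff_eq_bot.1 h.2⟩
  · exact .inr ⟨subsingleton_iff_eq_bot.1 h.1, subsingleton_iff_eq_bot.1 h.2⟩

theorem isCompl_ker_of_bijective_prod {E E₁ E₂ : Type*} [AddCommGroup E] [Module k E]
    [AddCommGroup E₁] [Module k E₁] [AddCommGroup E₂] [Module k E₂] {e : E →ₗ[k] E₁ × E₂}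
    (he : Function.Bijective e) :
    IsCompl (LinearMap.ker (LinearMap.snd k E₁ E₂ ∘ₗ e))
      (LinearMap.ker (LinearMap.fst k E₁ E₂ ∘ₗ e)) := by
  constructor
  · rw [disjoint_def]
    intro x h₂ h₁
    exact (map_eq_zero_iff e he.1).1 (Prod.ext h₁ h₂)
  · rw [codisjoint_iff, eq_top_iff]
    intro x _
    obtain ⟨y, hy⟩ := he.2 ((e x).1, 0)
    rw [← add_sub_cancel y x]
    refine add_mem_sup ?_ ?_ <;> simp [hy]

theorem subsingleton_of_ker_eq_bot {E E₁ E₂ : Type*} [AddCommGroup E] [Module k E]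
    [AddCommGroup E₁] [Module k E₁] [AddCommGroup E₂] [Module k E₂] {e : E →ₗ[k] E₁}
    {g : E →ₗ[k] E₂} (he : ∀ a b, ∃ x, e x = a ∧ g x = b) (h : LinearMap.ker g = ⊥) :
    Subsingleton E₁ := by
  refine subsingleton_of_forall_eq 0 fun a => ?_
  obtain ⟨x, rfl, hx⟩ := he a 0
  rw [(LinearMap.ker_eq_bot'.1 h) x hx, map_zero]

/-- An isomorphism with `A.prod B` is turned into an internal decomposition by the kernels of its
two components at each vertex. -/
theorem isIndecomposable_of_bilin {M : KroneckerRep.{u, v} n k}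
    (hM : BilinearRep.Indecomposable M.bilin) : M.IsIndecomposable := by
  refine ⟨hM.1, fun A B ⟨φ, hinj, hsurj⟩ => ?_⟩
  have hx : ∀ a b, ∃ x, (LinearMap.fst k A.X B.X ∘ₗ φ.x) x = a ∧
      (LinearMap.snd k A.X B.X ∘ₗ φ.x) x = b := fun a b => by
    obtain ⟨x, hx⟩ := hsurj.1 ((a, b) : A.X × B.X)
    exact ⟨x, congrArg Prod.fst hx, congrArg Prod.snd hx⟩
  have hy : ∀ a b, ∃ y, (LinearMap.fst k A.Y B.Y ∘ₗ φ.y) y = a ∧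
      (LinearMap.snd k A.Y B.Y ∘ₗ φ.y) y = b := fun a b => by
    obtain ⟨y, hy⟩ := hsurj.2 ((a, b) : A.Y × B.Y)
    exact ⟨y, congrArg Prod.fst hy, congrArg Prod.snd hy⟩
  have hcomm (i : Fin n) (x : M.X) : φ.y (M.map i x) = (A.prod B).map i (φ.x x) :=
    LinearMap.congr_fun (φ.comm i) x
  rcases hM.2 _ _ _ _
    (isCompl_ker_of_bijective_prod (E₁ := A.X) (E₂ := B.X) (e := φ.x) ⟨hinj.1, hsurj.1⟩)
    (isCompl_ker_of_bijective_prod (E₁ := A.Y) (E₂ := B.Y) (e := φ.y) ⟨hinj.2, hsurj.2⟩)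
    (M.bilin_mem_iff.2 fun i x (h : (φ.x x).2 = 0) => by
      have := (congrArg Prod.snd (hcomm i x)).trans
        ((congrArg (B.map i) h).trans (map_zero _))
      exact this)
    (M.bilin_mem_iff.2 fun i x (h : (φ.x x).1 = 0) => by
      have := (congrArg Prod.fst (hcomm i x)).trans
        ((congrArg (A.map i) h).trans (map_zero _))
      exact this) with h | h
  · left
    exact ⟨subsingleton_of_ker_eq_bot hx h.1, subsingleton_of_ker_eq_bot hy h.2⟩
  · right
    exact ⟨subsingleton_of_ker_eq_bot (fun a b => (hx b a).imp fun _ => And.symm) h.1,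
      subsingleton_of_ker_eq_bot (fun a b => (hy b a).imp fun _ => And.symm) h.2⟩

theorem isZero_iff_totalDim {M : KroneckerRep.{u, v} n k} : M.IsZero ↔ M.totalDim = 0 := by
  rw [IsZero, totalDim, Nat.add_eq_zero_iff, finrank_zero_iff, finrank_zero_iff]

theorem isSimple_of_totalDim_eq_one {M : KroneckerRep.{u, v} n k} (hM : M.totalDim = 1) :
    M.IsSimple := by
  refine ⟨by rw [isZero_iff_totalDim]; omega, fun A f hf => ?_⟩
  rw [isZero_iff_totalDim, or_iff_not_imp_left]
  intro hA
  have hx := LinearMap.finrank_le_finrank_of_injective hf.1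
  have hy := LinearMap.finrank_le_finrank_of_injective hf.2
  rw [totalDim] at hM hA
  exact ⟨(LinearMap.injective_iff_surjective_of_finrank_eq_finrank (by omega)).1 hf.1,
    (LinearMap.injective_iff_surjective_of_finrank_eq_finrank (by omega)).1 hf.2⟩

theorem IsIso.totalDim_eq {M N : KroneckerRep.{u, v} n k} (h : IsIso M N) :
    M.totalDim = N.totalDim := by
  obtain ⟨f, hi, hs⟩ := h
  rw [totalDim, totalDim, (LinearEquiv.ofBijective f.x ⟨hi.1, hs.1⟩).finrank_eq,
    (LinearEquiv.ofBijective f.y ⟨hi.2, hs.2⟩).finrank_eq]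

theorem totalDim_prod (A B : KroneckerRep.{u, v} n k) :
    (A.prod B).totalDim = A.totalDim + B.totalDim := by
  have hX : finrank k (A.prod B).X = finrank k A.X + finrank k B.X :=
    finrank_prod (R := k) (M := A.X) (M' := B.X)
  have hY : finrank k (A.prod B).Y = finrank k A.Y + finrank k B.Y :=
    finrank_prod (R := k) (M := A.Y) (M' := B.Y)
  simp only [totalDim]
  omega

theorem isIndecomposable_of_totalDim_eq_one {M : KroneckerRep.{u, v} n k}
    (hM : M.totalDim = 1) : M.IsIndecomposable := by
  refine ⟨by rw [isZero_iff_totalDim]; omega, fun A B h => ?_⟩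
  have := h.totalDim_eq
  rw [totalDim_prod] at this
  rw [isZero_iff_totalDim, isZero_iff_totalDim]
  omega

/-! ### Exact sequences with a simple end term, and accessibility -/

/-- The subrepresentation given by a subspace of `M(x)` and all of `M(y)`. -/
def restrictSource (M : KroneckerRep.{u, v} n k) (P : Submodule k M.X) :
    KroneckerRep.{u, v} n k where
  X := P
  Y := M.Y
  map i := M.map i ∘ₗ P.subtype

/-- The quotient of `M` by a subspace of `M(y)`. -/
def quotientSink (M : KroneckerRep.{u, v} n k) (Q : Submodule k M.Y) :
    KroneckerRep.{u, v} n k where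
  X := M.X
  Y := M.Y ⧸ Q
  map i := Q.mkQ ∘ₗ M.map i

theorem bilin_restrictSource (M : KroneckerRep.{u, v} n k) (P : Submodule k M.X) :
    (M.restrictSource P).bilin = BilinearRep.restrict M.bilin P := by
  refine LinearMap.ext fun x => LinearMap.ext fun c => ?_
  rw [bilin_apply]
  exact (bilin_apply M _ c).symm

theorem bilin_quotientSink (M : KroneckerRep.{u, v} n k) (Q : Submodule k M.Y) :
    (M.quotientSink Q).bilin = BilinearRep.quotient M.bilin Q := by
  refine LinearMap.ext fun (x : M.X) => LinearMap.ext fun c => ?_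
  have h : Q.mkQ (M.bilin x c) = ∑ i, c i • Q.mkQ (M.map i x) := by
    simp only [bilin_apply, map_sum, map_smul]
  exact (bilin_apply (M.quotientSink Q) x c).trans h.symm

/-- A representation concentrated at the source. -/
def ofSource (n : ℕ) (k : Type u) [Field k] (E : Type v) [AddCommGroup E] [Module k E]
    [FiniteDimensional k E] : KroneckerRep.{u, v} n k where
  X := E
  Y := PUnit
  map _ := 0

/-- A representation concentrated at the sink. -/
def ofSink (n : ℕ) (k : Type u) [Field k] (E : Type v) [AddCommGroup E] [Module k E]
    [FiniteDimensional k E] : KroneckerRep.{u, v} n k where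
  X := PUnit
  Y := E
  map _ := 0

theorem totalDim_ofSource (E : Type v) [AddCommGroup E] [Module k E] [FiniteDimensional k E] :
    (ofSource n k E).totalDim = finrank k E := by
  have : finrank k (PUnit : Type v) = 0 := finrank_zero_of_subsingleton
  exact congrArg (finrank k E + ·) this

theorem totalDim_ofSink (E : Type v) [AddCommGroup E] [Module k E] [FiniteDimensional k E] :
    (ofSink n k E).totalDim = finrank k E := by
  have : finrank k (PUnit : Type v) = 0 := finrank_zero_of_subsingleton
  exact (congrArg (· + finrank k E) this).trans (Nat.zero_add _)

/-- An indecomposable representation of dimension between two and six has an indecomposable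
subrepresentation or quotient of codimension one. -/
theorem IsIndecomposable.exists_isIndecomposable [Infinite k] {M : KroneckerRep.{u, v} 3 k}
    (hM : M.IsIndecomposable) (h₂ : 2 ≤ M.totalDim) (h₆ : M.totalDim ≤ 6) :
    (∃ P : Submodule k M.X, finrank k P + 1 = finrank k M.X ∧
      (M.restrictSource P).IsIndecomposable) ∨
    ∃ Q : Submodule k M.Y, finrank k Q = 1 ∧ (M.quotientSink Q).IsIndecomposable := by
  rcases hM.bilin.hasIndecomposableNeighbor (by simp) h₂ h₆ with ⟨P, hP, h⟩ | ⟨Q, hQ, h⟩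
  · exact .inl ⟨P, hP, isIndecomposable_of_bilin (by rwa [bilin_restrictSource])⟩
  · exact .inr ⟨Q, hQ, isIndecomposable_of_bilin (by rwa [bilin_quotientSink])⟩

/-- The inclusion of `M.restrictSource P`. -/
def restrictSourceHom (M : KroneckerRep.{u, v} n k) (P : Submodule k M.X) :
    Hom (M.restrictSource P) M where
  x := P.subtype
  y := LinearMap.id
  comm _ := rfl

/-- The projection to `M.quotientSink Q`. -/
def quotientSinkHom (M : KroneckerRep.{u, v} n k) (Q : Submodule k M.Y) :
    Hom M (M.quotientSink Q) where
  x := LinearMap.id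
  y := Q.mkQ
  comm _ := rfl

/-- The projection from `M` to the cokernel of the inclusion of `M.restrictSource P`. -/
def toOfSource (M : KroneckerRep.{u, v} n k) (P : Submodule k M.X) :
    Hom M (ofSource n k (M.X ⧸ P)) where
  x := P.mkQ
  y := 0
  comm _ := rfl

/-- The inclusion of the kernel of the projection to `M.quotientSink Q`. -/
def ofSinkTo (M : KroneckerRep.{u, v} n k) (Q : Submodule k M.Y) :
    Hom (ofSink n k Q) M where
  x := 0
  y := Q.subtype
  comm i := by
    refine LinearMap.ext fun _ => ?_
    exact (map_zero (M.map i)).symm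

theorem isShortExact_restrictSource (M : KroneckerRep.{u, v} n k) (P : Submodule k M.X) :
    IsShortExact (M.restrictSourceHom P) (M.toOfSource P) := by
  refine ⟨⟨P.injective_subtype, Function.injective_id⟩,
    ⟨P.mkQ_surjective, fun y => ⟨0, Subsingleton.elim (α := PUnit) _ _⟩⟩,
    LinearMap.exact_subtype_mkQ P, fun y => ⟨fun _ => ⟨y, rfl⟩, fun _ => rfl⟩⟩

theorem isShortExact_quotientSink (M : KroneckerRep.{u, v} n k) (Q : Submodule k M.Y) :
    IsShortExact (M.ofSinkTo Q) (M.quotientSinkHom Q) := by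
  refine ⟨⟨fun x y _ => Subsingleton.elim (α := PUnit) x y, Q.injective_subtype⟩,
    ⟨Function.surjective_id, Q.mkQ_surjective⟩,
    fun x => ⟨fun h => ⟨PUnit.unit, h.symm⟩, ?_⟩, LinearMap.exact_subtype_mkQ Q⟩
  rintro ⟨_, rfl⟩
  rfl

theorem totalDim_restrictSource (M : KroneckerRep.{u, v} n k) {P : Submodule k M.X}
    (hP : finrank k P + 1 = finrank k M.X) : (M.restrictSource P).totalDim + 1 = M.totalDim := by
  change finrank k P + finrank k M.Y + 1 = finrank k M.X + finrank k M.Y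
  omega

theorem totalDim_quotientSink (M : KroneckerRep.{u, v} n k) {Q : Submodule k M.Y}
    (hQ : finrank k Q = 1) : (M.quotientSink Q).totalDim + 1 = M.totalDim := by
  change finrank k M.X + finrank k (M.Y ⧸ Q) + 1 = finrank k M.X + finrank k M.Y
  have := finrank_quotient_add_finrank Q
  omega

/-- Induction on the dimension: the neighbour of codimension one is again indecomposable and within
the bound. -/
theorem IsIndecomposable.isAccessible [Infinite k] {M : KroneckerRep.{u, v} 3 k}
    (hM : M.IsIndecomposable) (h₆ : M.totalDim ≤ 6) : M.IsAccessible := by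
  induction h : M.totalDim using Nat.strong_induction_on generalizing M with
  | _ d ih =>
    subst h
    by_cases h₁ : M.totalDim = 1
    · exact .of_simple M (isSimple_of_totalDim_eq_one h₁)
    have h₀ := mt isZero_iff_totalDim.2 hM.1
    rcases hM.exists_isIndecomposable (by omega) h₆ with ⟨P, hP, h⟩ | ⟨Q, hQ, h⟩
    · have hdim := M.totalDim_restrictSource hP
      exact .of_sub M _ (M.restrictSourceHom P) hM (M.isShortExact_restrictSource P).1 hdim
        (ih _ (by omega) h (by omega) rfl)
    · have hdim := M.totalDim_quotientSink hQ
      exact .of_quotient M _ (M.quotientSinkHom Q) hM (M.isShortExact_quotientSink Q).2.1 hdim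
        (ih _ (by omega) h (by omega) rfl)

end KroneckerRep

theorem mainTheorem11 {k : Type u} [Field k] [IsAlgClosed k] (M : KroneckerRep.{u, v} 3 k)
    (hM : M.IsIndecomposable) (hdim : M.totalDim ≤ 6) :
    (¬ M.IsSimple →
      ∃ (U₁ U₂ : KroneckerRep.{u, v} 3 k) (f : KroneckerRep.Hom U₁ M) (g : KroneckerRep.Hom M U₂),
        KroneckerRep.IsShortExact f g ∧ U₁.IsIndecomposable ∧ U₂.IsIndecomposable ∧
          (U₁.IsSimple ∨ U₂.IsSimple)) ∧
    M.IsAccessible := by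
  refine ⟨fun hs => ?_, hM.isAccessible hdim⟩
  have h₀ := mt KroneckerRep.isZero_iff_totalDim.2 hM.1
  have h₁ := mt KroneckerRep.isSimple_of_totalDim_eq_one hs
  rcases hM.exists_isIndecomposable (by omega) hdim with ⟨P, hP, h⟩ | ⟨Q, hQ, h⟩
  · have hU : (KroneckerRep.ofSource 3 k (M.X ⧸ P)).totalDim = 1 := by
      rw [KroneckerRep.totalDim_ofSource]
      have := finrank_quotient_add_finrank P
      omega
    exact ⟨_, _, _, _, M.isShortExact_restrictSource P, h,
      KroneckerRep.isIndecomposable_of_totalDim_eq_one hU,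
      .inr (KroneckerRep.isSimple_of_totalDim_eq_one hU)⟩
  · have hU : (KroneckerRep.ofSink 3 k Q).totalDim = 1 := by
      rw [KroneckerRep.totalDim_ofSink, hQ]
    exact ⟨_, _, _, _, M.isShortExact_quotientSink Q,
      KroneckerRep.isIndecomposable_of_totalDim_eq_one hU, h,
      .inl (KroneckerRep.isSimple_of_totalDim_eq_one hU)⟩
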